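/- Let $\Bbbk$ be a field (of any characteristic). Operads are symmetric operads over $\Bbbk$ with right $\mathbb S_n$-actions $*$, partial compositions $\circ_i:P(m)\otimes P(n)\to P(m+n-1)$ ($1\le i\le m$, $n\ge 0$) and identity $\mathbf 1\in P(1)$. For permutations $\phi\in\mathbb S_m$, $\sigma\in\mathbb S_n$, $\phi\circ_i\sigma\in\mathbb S_{m+n-1}$ denotes the permutation obtained by replacing the letter $i$ by a block of $n$ letters, permuting the block internally by $\sigma$, and permuting the remaining letters and the block as a whole by $\phi$; $1_m$ is the identity of $\mathbb S_m$. Let $\mathcal{A}s$ be the operad of unital associative algebras: $\mathcal{A}s(n)=\Bbbk\mathbb S_n$ for all $n\ge 0$, with the right regular action and the bilinearly extended compositions $\circ_i$ of permutations. For $I\subseteq\{1,\dots,n\}$ let $\pi^I(\theta)=\theta\circ(1_{\chi_I(1)},\dots,1_{\chi_I(n)})$ for $\theta\in\mathcal{A}s(n)$, where $\chi_I$ is the characteristic function of $I$ (so $1_0\in\mathcal{A}s(0)$ is inserted in the slots outside $I$). For $k\ge 1$ the $k$-th truncation ideal ${}^kI$ is given by ${}^kI(n)=\bigcap_{|I|=k-1}\ker\pi^I$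 if $n\ge k$, and ${}^kI(n)=0$ if $n<k$. For an operad $P$, a 2-cocycle is a pair $(\wp,\varsigma)$ of families of linear maps $\wp_i:P(m)\otimes P(n)\to P(m+n-1)$ ($1\le i\le m$, $n\ge 0$) and $\varsigma:P(m)\otimes\Bbbk\mathbb S_m\to P(m)$ ($m\ge 0$) such that, for $\lambda\in P(l)$, $\mu\in P(m)$, $\nu\in P(n)$, $\phi,\tau\in\mathbb S_m$ and $\sigma\in\mathbb S_n$, $$\wp_{i-1+j}(\lambda\circ_i\mu,\nu)+\wp_i(\lambda,\mu)\circ_{i-1+j}\nu=\wp_i(\lambda,\mu\circ_j\nu)+\lambda\circ_i\wp_j(\mu,\nu)\quad(1\le i\le l,\ 1\le j\le m),$$ $$\wp_{s-1+m}(\lambda\circ_i\mu,\nu)+\wp_i(\lambda,\mu)\circ_{s-1+m}\nu=\wp_i(\lambda\circ_s\nu,\mu)+\wp_s(\lambda,\nu)\circ_i\mu\quad(1\le i<s\le l),$$ $$\wp_i(\mu,\nu*\sigma)+\mu\circ_i\varsigma(\nu,\sigma)=\wp_i(\mu,\nu)*\sigma'+\varsigma(\mu\circ_i\nu,\sigma'),\qquad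 \sigma'=1_m\circ_i\sigma,$$ $$\wp_i(\mu*\phi,\nu)+\varsigma(\mu,\phi)\circ_i\nu=\wp_{\phi(i)}(\mu,\nu)*\phi''+\varsigma(\mu\circ_{\phi(i)}\nu,\phi''),\qquad \phi''=\phi\circ_i 1_n,$$ $$\varsigma(\mu,\phi\tau)=\varsigma(\mu*\phi,\tau)+\varsigma(\mu,\phi)*\tau .$$ It is a 2-coboundary if there is an arity-preserving linear map $\partial:P\to P$ with $\wp_i(\mu,\nu)=\partial(\mu\circ_i\nu)-\partial(\mu)\circ_i\nu-\mu\circ_i\partial(\nu)$ and $\varsigma(\mu,\sigma)=\partial(\mu*\sigma)-\partial(\mu)*\sigma$. Let $H^2_*(P)$ be the space of 2-cocycles modulo 2-coboundaries, and $H^2(P)$ the space of 2-cocycles with $\varsigma=0$ modulo 2-coboundaries with $\varsigma=0$. An infinitesimal deformation of $P$ is a $\Bbbk[\epsilon]$-linear operad structure ($\epsilon^2=0$) on $P[\epsilon]=P\otimes\Bbbk[\epsilon]$ with identity $\mathbf 1$, whose compositions and actions have the form $\mu\circ_i^\epsilon\nu=\mu\circ_i\nu+\wp_i(\mu,\nu)\epsilon$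 and $\mu*^\epsilon\sigma=\mu*\sigma+\varsigma(\mu,\sigma)\epsilon$ for $\mu,\nu\in P$, with $\Bbbk$-linear $\wp_i$ and $\varsigma$. It is trivial if there is a $\Bbbk[\epsilon]$-linear isomorphism of operads, of the form $\mu\mapsto\mu+\partial(\mu)\epsilon$ for $\mu\in P$ with $\partial:P\to P$ an arity-preserving $\Bbbk$-linear map, from it to the deformation with $\wp=0$ and $\varsigma=0$. **Theorem.** Let $k\ge 1$ be an integer with $k\ne 4$, and let $P=\mathcal{A}s/{}^kI$. Then $H^2(P)=0$ and $H^2_*(P)=0$, and every infinitesimal deformation of $P$ is trivial. -/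

import Mathlib

universe u v

open scoped TensorProduct DualNumber

/-! ## Partial composition of permutations -/

/-- The letters `0, …, k - 1` (`m + n = k + 1`) obtained from `0, …, m - 1` by replacing the letter
`i` with a block of `n` consecutive letters: `inl b` is the letter that comes from `b ≠ i`, and
`inr t` is the `t`-th letter of the inserted block. -/
def slotFun {m n k : ℕ} (h : m + n = k + 1) (i : Fin m) :
    {b : Fin m // b ≠ i} ⊕ Fin n → Fin k
  | Sum.inl b =>
      if hb : (b.1 : ℕ) < i then ⟨b.1, by omega⟩
      else ⟨b.1 + n - 1, by
        have h1 := b.1.isLt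
        have h2 : (b.1 : ℕ) ≠ i := fun e => b.2 (Fin.ext e)
        omega⟩
  | Sum.inr t => ⟨i + t, by omega⟩

theorem slotFun_inl_val {m n k : ℕ} (h : m + n = k + 1) (i : Fin m) (b : {b : Fin m // b ≠ i}) :
    (slotFun h i (Sum.inl b) : ℕ) = if (b.1 : ℕ) < i then (b.1 : ℕ) else b.1 + n - 1 := by
  simp only [slotFun]
  split_ifs <;> rfl

theorem slotFun_inr_val {m n k : ℕ} (h : m + n = k + 1) (i : Fin m) (t : Fin n) :
    (slotFun h i (Sum.inr t) : ℕ) = i + t := rfl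

theorem slotFun_bijective {m n k : ℕ} (h : m + n = k + 1) (i : Fin m) :
    Function.Bijective (slotFun h i) := by
  constructor
  · rintro (b | t) (b' | t') e
    · have e' := congrArg Fin.val e
      rw [slotFun_inl_val, slotFun_inl_val] at e'
      have h1 : (b.1 : ℕ) ≠ i := fun e => b.2 (Fin.ext e)
      have h2 : (b'.1 : ℕ) ≠ i := fun e => b'.2 (Fin.ext e)
      congr 1
      apply Subtype.ext
      apply Fin.ext
      split_ifs at e' <;> omega
    · exfalso
      have e' := congrArg Fin.val e
      rw [slotFun_inl_val, slotFun_inr_val] at e'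
      have h1 : (b.1 : ℕ) ≠ i := fun e => b.2 (Fin.ext e)
      have := t'.isLt
      split_ifs at e' <;> omega
    · exfalso
      have e' := congrArg Fin.val e
      rw [slotFun_inl_val, slotFun_inr_val] at e'
      have h1 : (b'.1 : ℕ) ≠ i := fun e => b'.2 (Fin.ext e)
      have := t.isLt
      split_ifs at e' <;> omega
    · have e' := congrArg Fin.val e
      rw [slotFun_inr_val, slotFun_inr_val] at e'
      congr 1
      apply Fin.ext
      omega
  · intro c
    have hi := i.isLt
    have hc := c.isLt
    by_cases h1 : (c : ℕ) < i
    · refine ⟨Sum.inl ⟨⟨c, by omega⟩, fun e => ?_⟩, Fin.ext ?_⟩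
      · have := congrArg Fin.val e
        simp only at this
        omega
      · rw [slotFun_inl_val]
        simp [h1]
    · by_cases h2 : (c : ℕ) < i + n
      · refine ⟨Sum.inr ⟨c - i, by omega⟩, Fin.ext ?_⟩
        rw [slotFun_inr_val]
        simp only
        omega
      · refine ⟨Sum.inl ⟨⟨c + 1 - n, by omega⟩, fun e => ?_⟩, Fin.ext ?_⟩
        · have := congrArg Fin.val e
          simp only at this
          omega
        · rw [slotFun_inl_val]
          simp only
          rw [if_neg (by omega)]
          omega

/-- `slotFun` as a bijection. -/
noncomputable def slotEquiv {m n k : ℕ} (h : m + n = k + 1) (i : Fin m) :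
    {b : Fin m // b ≠ i} ⊕ Fin n ≃ Fin k :=
  Equiv.ofBijective (slotFun h i) (slotFun_bijective h i)

/-- The partial composition `σ ∘_i τ ∈ S_{m+n-1}` of `σ ∈ S_m` and `τ ∈ S_n`: the letter `i` is
replaced by a block of `n` letters, `τ` permutes the letters of the block, and `σ` permutes the
remaining letters and the block as a whole (the block arrives at place `σ i`). -/
noncomputable def permComp {m n k : ℕ} (h : m + n = k + 1) (i : Fin m)
    (σ : Equiv.Perm (Fin m)) (τ : Equiv.Perm (Fin n)) : Equiv.Perm (Fin k) :=
  (slotEquiv h i).symm.trans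
    ((Equiv.sumCongr
      (σ.subtypeEquiv (p := fun b => b ≠ i) (q := fun b => b ≠ σ i)
        (fun _ => (not_congr σ.injective.eq_iff).symm)) τ).trans
      (slotEquiv h (σ i)))

theorem permComp_inl {m n k : ℕ} (h : m + n = k + 1) (i : Fin m)
    (σ : Equiv.Perm (Fin m)) (τ : Equiv.Perm (Fin n)) (b : {b : Fin m // b ≠ i}) :
    permComp h i σ τ (slotFun h i (Sum.inl b)) =
      slotFun h (σ i) (Sum.inl ⟨σ b.1, fun e => b.2 (σ.injective e)⟩) := by
  have : (slotEquiv h i).symm (slotFun h i (Sum.inl b)) = Sum.inl b :=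
    (slotEquiv h i).symm_apply_apply (Sum.inl b)
  simp only [permComp, Equiv.trans_apply, this]
  rfl

theorem permComp_inr {m n k : ℕ} (h : m + n = k + 1) (i : Fin m)
    (σ : Equiv.Perm (Fin m)) (τ : Equiv.Perm (Fin n)) (t : Fin n) :
    permComp h i σ τ (slotFun h i (Sum.inr t)) = slotFun h (σ i) (Sum.inr (τ t)) := by
  have : (slotEquiv h i).symm (slotFun h i (Sum.inr t)) = Sum.inr t :=
    (slotEquiv h i).symm_apply_apply (Sum.inr t)
  simp only [permComp, Equiv.trans_apply, this]
  rfl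

/-- A letter `b ≠ i` of the outer permutation keeps its image. -/
theorem permComp_val_outer {m n k : ℕ} (h : m + n = k + 1) (i : Fin m)
    (σ : Equiv.Perm (Fin m)) (τ : Equiv.Perm (Fin n)) (b : Fin m) (hb : b ≠ i) (c : Fin k)
    (hc : (c : ℕ) = if (b : ℕ) < i then (b : ℕ) else b + n - 1) :
    (permComp h i σ τ c : ℕ) =
      if (σ b : ℕ) < σ i then (σ b : ℕ) else σ b + n - 1 := by
  have : c = slotFun h i (Sum.inl ⟨b, hb⟩) := Fin.ext (by rw [hc, slotFun_inl_val])
  rw [this, permComp_inl, slotFun_inl_val]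

theorem permComp_val_inner {m n k : ℕ} (h : m + n = k + 1) (i : Fin m)
    (σ : Equiv.Perm (Fin m)) (τ : Equiv.Perm (Fin n)) (t : Fin n) (c : Fin k)
    (hc : (c : ℕ) = i + t) :
    (permComp h i σ τ c : ℕ) = σ i + τ t := by
  have : c = slotFun h i (Sum.inr t) := Fin.ext (by rw [hc, slotFun_inr_val])
  rw [this, permComp_inr, slotFun_inr_val]

theorem permComp_one_right {m : ℕ} (h : m + 1 = m + 1) (i : Fin m) (σ : Equiv.Perm (Fin m)) :
    permComp h i σ (1 : Equiv.Perm (Fin 1)) = σ := by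
  ext c
  by_cases hc : c = i
  · subst hc
    rw [permComp_val_inner h c σ 1 0 c (by simp)]
    simp
  · rw [permComp_val_outer h i σ 1 c hc c (by split_ifs <;> simp)]
    split_ifs <;> simp

theorem permComp_one_left {n : ℕ} (h : 1 + n = n + 1) (τ : Equiv.Perm (Fin n)) :
    permComp h 0 (1 : Equiv.Perm (Fin 1)) τ = τ := by
  ext c
  rw [permComp_val_inner h 0 1 τ c c (by simp)]
  simp

theorem permComp_mul {m n k : ℕ} (h : m + n = k + 1) (i : Fin m)
    (σ φ : Equiv.Perm (Fin m)) (τ ρ : Equiv.Perm (Fin n)) :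
    permComp h i (σ * φ) (τ * ρ) = permComp h (φ i) σ τ * permComp h i φ ρ := by
  ext c
  obtain ⟨x, rfl⟩ := (slotFun_bijective h i).2 c
  rw [Equiv.Perm.mul_apply]
  rcases x with b | t
  · rw [permComp_inl, permComp_inl, permComp_inl]
    rfl
  · rw [permComp_inr, permComp_inr, permComp_inr]
    rfl

theorem permComp_assoc {l m n p q r : ℕ} (hp : l + m = p + 1) (hr : p + n = r + 1)
    (hq : m + n = q + 1) (hr' : l + q = r + 1) (i : Fin l) (j : Fin m) (a : Fin p)
    (ha : (a : ℕ) = i + j) (σ : Equiv.Perm (Fin l)) (τ : Equiv.Perm (Fin m))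
    (ρ : Equiv.Perm (Fin n)) :
    permComp hr a (permComp hp i σ τ) ρ = permComp hr' i σ (permComp hq j τ ρ) := by
  have hpa : (permComp hp i σ τ a : ℕ) = σ i + τ j := permComp_val_inner hp i σ τ j a ha
  have hj := j.isLt
  have hτj := (τ j).isLt
  ext c
  obtain ⟨x, rfl⟩ := (slotFun_bijective hr' i).2 c
  rcases x with b | t
  · have hb : (b.1 : ℕ) ≠ i := fun e => b.2 (Fin.ext e)
    have hσ : (σ b.1 : ℕ) ≠ σ i := fun e => b.2 (σ.injective (Fin.ext e))
    rw [permComp_inl, slotFun_inl_val]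
    let d : Fin p := slotFun hp i (Sum.inl b)
    have hd : (d : ℕ) = _ := slotFun_inl_val hp i b
    have hpd : (permComp hp i σ τ d : ℕ) = _ := permComp_val_outer hp i σ τ b.1 b.2 d hd
    have hda : d ≠ a := by
      intro e
      have := congrArg Fin.val e
      rw [hd, ha] at this
      split_ifs at this <;> omega
    rw [permComp_val_outer hr a _ ρ d hda _ (by
      rw [slotFun_inl_val, hd, ha]
      split_ifs <;> omega), hpd, hpa]
    simp only
    split_ifs <;> omega
  · obtain ⟨y, rfl⟩ := (slotFun_bijective hq j).2 t
    rw [permComp_inr, slotFun_inr_val]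
    rcases y with b | s
    · have hb : (b.1 : ℕ) ≠ j := fun e => b.2 (Fin.ext e)
      have hτ : (τ b.1 : ℕ) ≠ τ j := fun e => b.2 (τ.injective (Fin.ext e))
      rw [permComp_inl, slotFun_inl_val]
      let d : Fin p := slotFun hp i (Sum.inr b.1)
      have hd : (d : ℕ) = _ := slotFun_inr_val hp i b.1
      have hpd : (permComp hp i σ τ d : ℕ) = _ := permComp_val_inner hp i σ τ b.1 d hd
      have hda : d ≠ a := by
        intro e
        have := congrArg Fin.val e
        rw [hd, ha] at this
        omega
      rw [permComp_val_outer hr a _ ρ d hda _ (by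
        rw [slotFun_inr_val, slotFun_inl_val, hd, ha]
        split_ifs <;> omega), hpd, hpa]
      simp only
      split_ifs <;> omega
    · rw [permComp_inr, slotFun_inr_val]
      rw [permComp_val_inner hr a _ ρ s _ (by
        rw [slotFun_inr_val, slotFun_inr_val, ha]; omega), hpa]
      omega

theorem permComp_comm {l m n p q r : ℕ} (hp : l + m = p + 1) (hr : p + n = r + 1)
    (hq : l + n = q + 1) (hr' : q + m = r + 1) (i k : Fin l) (hik : i < k) (a : Fin p)
    (ha : (a : ℕ) + 1 = k + m) (b : Fin q) (hb : (b : ℕ) = i) (σ : Equiv.Perm (Fin l))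
    (τ : Equiv.Perm (Fin m)) (ρ : Equiv.Perm (Fin n)) :
    permComp hr a (permComp hp i σ τ) ρ = permComp hr' b (permComp hq k σ ρ) τ := by
  have hik' : (i : ℕ) < k := hik
  have hne : (σ i : ℕ) ≠ σ k := fun e => (ne_of_lt hik) (σ.injective (Fin.ext e))
  have hpa : (permComp hp i σ τ a : ℕ) = _ :=
    permComp_val_outer hp i σ τ k (ne_of_gt hik) a (by rw [if_neg (by omega)]; omega)
  have hqb : (permComp hq k σ ρ b : ℕ) = _ :=
    permComp_val_outer hq k σ ρ i (ne_of_lt hik) b (by rw [if_pos (by omega)]; omega)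
  ext c
  obtain ⟨x, rfl⟩ := (slotFun_bijective hr a).2 c
  rcases x with d | s
  · obtain ⟨y, hy⟩ := (slotFun_bijective hp i).2 d.1
    have hda : (d.1 : ℕ) ≠ a := fun e => d.2 (Fin.ext e)
    rcases y with e | t
    · have hd := congrArg Fin.val hy
      rw [slotFun_inl_val] at hd
      have hei : (e.1 : ℕ) ≠ i := fun h => e.2 (Fin.ext h)
      have hek : e.1 ≠ k := by
        intro h
        rw [h] at hd
        rw [if_neg (by omega)] at hd
        omega
      have hek' : (e.1 : ℕ) ≠ k := fun h => hek (Fin.ext h)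
      have hσi : (σ e.1 : ℕ) ≠ σ i := fun h => e.2 (σ.injective (Fin.ext h))
      have hσk : (σ e.1 : ℕ) ≠ σ k := fun h => hek (σ.injective (Fin.ext h))
      have hpd : (permComp hp i σ τ d.1 : ℕ) = _ :=
        permComp_val_outer hp i σ τ e.1 e.2 d.1 hd.symm
      let f : Fin q := slotFun hq k (Sum.inl ⟨e.1, hek⟩)
      have hf : (f : ℕ) = _ := slotFun_inl_val hq k ⟨e.1, hek⟩
      simp only at hf
      have hqf : (permComp hq k σ ρ f : ℕ) = _ := permComp_val_outer hq k σ ρ e.1 hek f hf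
      have hfb : f ≠ b := by
        intro h
        have := congrArg Fin.val h
        rw [hf, hb] at this
        split_ifs at this <;> omega
      rw [permComp_inl, slotFun_inl_val]
      rw [permComp_val_outer hr' b _ τ f hfb _ (by
        rw [slotFun_inl_val, hf, hb, ← hd]
        split_ifs <;> omega), hqf, hqb]
      simp only [hpd, hpa]
      split_ifs <;> omega
    · have hd := congrArg Fin.val hy
      rw [slotFun_inr_val] at hd
      have ht := t.isLt
      have hτ := (τ t).isLt
      have hpd : (permComp hp i σ τ d.1 : ℕ) = _ :=
        permComp_val_inner hp i σ τ t d.1 hd.symm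
      rw [permComp_inl, slotFun_inl_val]
      rw [permComp_val_inner hr' b _ τ t _ (by
        rw [slotFun_inl_val, hb, ← hd]
        split_ifs <;> omega), hqb]
      simp only [hpd, hpa]
      split_ifs <;> omega
  · rw [permComp_inr, slotFun_inr_val]
    have hs := s.isLt
    have hρ := (ρ s).isLt
    let f : Fin q := slotFun hq k (Sum.inr s)
    have hf : (f : ℕ) = _ := slotFun_inr_val hq k s
    have hqf : (permComp hq k σ ρ f : ℕ) = _ := permComp_val_inner hq k σ ρ s f hf
    have hfb : f ≠ b := by
      intro h
      have := congrArg Fin.val h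
      rw [hf, hb] at this
      omega
    rw [permComp_val_outer hr' b _ τ f hfb _ (by
      rw [slotFun_inr_val, hf, hb]
      split_ifs <;> omega), hqf, hqb, hpa]
    split_ifs <;> omega

/-! ## Operads -/

/-- A symmetric operad structure over a commutative ring `R` on a sequence `(M n)_{n ≥ 0}` of
`R`-modules, in the partial-composition presentation.

* Slots and permuted letters are numbered from `0`: the classical `i`-th slot, `1 ≤ i ≤ m`, is
  the element `i - 1` of `Fin m`.
* The partial composition `∘_i : M m ⊗ M n → M (m + n - 1)` is given as a bilinear map into `M k`
  for the unique `k` with `m + n = k + 1` (note `m ≥ 1`, since `i : Fin m`).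
* `act σ x` is `x * σ`, the right action of `S_n` on `M n`. -/
structure OperadStructure (R : Type u) [CommRing R] (M : ℕ → Type v)
    [∀ n, AddCommGroup (M n)] [∀ n, Module R (M n)] where
  one : M 1
  act : ∀ {n : ℕ}, Equiv.Perm (Fin n) → (M n →ₗ[R] M n)
  comp : ∀ {m n k : ℕ}, m + n = k + 1 → Fin m → (M m →ₗ[R] M n →ₗ[R] M k)
  act_one : ∀ {n : ℕ} (x : M n), act 1 x = x
  act_mul : ∀ {n : ℕ} (σ τ : Equiv.Perm (Fin n)) (x : M n), act (σ * τ) x = act τ (act σ x)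
  comp_one : ∀ {m : ℕ} (h : m + 1 = m + 1) (i : Fin m) (x : M m), comp h i x one = x
  one_comp : ∀ {n : ℕ} (h : 1 + n = n + 1) (x : M n), comp h 0 one x = x
  comp_assoc : ∀ {l m n p q r : ℕ} (hp : l + m = p + 1) (hr : p + n = r + 1)
    (hq : m + n = q + 1) (hr' : l + q = r + 1) (i : Fin l) (j : Fin m) (a : Fin p),
    (a : ℕ) = i + j → ∀ (x : M l) (y : M m) (z : M n),
    comp hr a (comp hp i x y) z = comp hr' i x (comp hq j y z)
  comp_comm : ∀ {l m n p q r : ℕ} (hp : l + m = p + 1) (hr : p + n = r + 1)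
    (hq : l + n = q + 1) (hr' : q + m = r + 1) (i k : Fin l), i < k →
    ∀ (a : Fin p), (a : ℕ) + 1 = k + m → ∀ (b : Fin q), (b : ℕ) = i →
    ∀ (x : M l) (y : M m) (z : M n),
    comp hr a (comp hp i x y) z = comp hr' b (comp hq k x z) y
  comp_act_right : ∀ {m n k : ℕ} (h : m + n = k + 1) (i : Fin m) (x : M m) (y : M n)
    (σ : Equiv.Perm (Fin n)),
    comp h i x (act σ y) = act (permComp h i 1 σ) (comp h i x y)
  comp_act_left : ∀ {m n k : ℕ} (h : m + n = k + 1) (i : Fin m) (x : M m) (y : M n)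
    (φ : Equiv.Perm (Fin m)),
    comp h i (act φ x) y = act (permComp h i φ 1) (comp h (φ i) x y)

/-! ## The operad of unital associative algebras -/

/-- The right action of `S_n` on the group module `R[S_n]`, `x * σ`. -/
noncomputable def asAct (R : Type u) [CommRing R] {n : ℕ} (σ : Equiv.Perm (Fin n)) :
    (Equiv.Perm (Fin n) →₀ R) →ₗ[R] (Equiv.Perm (Fin n) →₀ R) :=
  Finsupp.lmapDomain R R (fun τ => τ * σ)

/-- The bilinear extension of the partial composition of permutations. -/
noncomputable def asComp (R : Type u) [CommRing R] {m n k : ℕ} (h : m + n = k + 1) (i : Fin m) :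
    (Equiv.Perm (Fin m) →₀ R) →ₗ[R] (Equiv.Perm (Fin n) →₀ R) →ₗ[R]
      (Equiv.Perm (Fin k) →₀ R) :=
  Finsupp.linearCombination R (fun σ => Finsupp.lmapDomain R R (fun τ => permComp h i σ τ))

theorem asAct_single (R : Type u) [CommRing R] {n : ℕ} (σ τ : Equiv.Perm (Fin n)) (c : R) :
    asAct R σ (Finsupp.single τ c) = Finsupp.single (τ * σ) c := by
  simp [asAct]

theorem asComp_single (R : Type u) [CommRing R] {m n k : ℕ} (h : m + n = k + 1) (i : Fin m)
    (σ : Equiv.Perm (Fin m)) (τ : Equiv.Perm (Fin n)) (c d : R) :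
    asComp R h i (Finsupp.single σ c) (Finsupp.single τ d) =
      Finsupp.single (permComp h i σ τ) (c * d) := by
  rw [asComp, Finsupp.linearCombination_single, LinearMap.smul_apply, Finsupp.lmapDomain_apply,
    Finsupp.mapDomain_single, Finsupp.smul_single, smul_eq_mul]

/-- The operad `As` encoding unital associative algebras: `As(n)` is the group module `R[S_n]`
(the free module on the elements of `S_n`) for every `n ≥ 0`, with the right regular action, and
the partial compositions extend those of permutations bilinearly. -/
noncomputable def asOperad (R : Type u) [CommRing R] :
    OperadStructure R (fun n => Equiv.Perm (Fin n) →₀ R) where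
  one := Finsupp.single 1 1
  act σ := asAct R σ
  comp h i := asComp R h i
  act_one x := by
    induction x using Finsupp.induction_linear with
    | zero => simp
    | add x y hx hy => rw [map_add, hx, hy]
    | single σ c => rw [asAct_single, mul_one]
  act_mul σ τ x := by
    induction x using Finsupp.induction_linear with
    | zero => simp
    | add x y hx hy => rw [map_add, hx, hy, ← map_add, ← map_add]
    | single σ c => simp only [asAct_single, mul_assoc]
  comp_one h i x := by
    induction x using Finsupp.induction_linear with
    | zero => simp
    | add x y hx hy => rw [map_add, LinearMap.add_apply, hx, hy]
    | single σ c => rw [asComp_single, permComp_one_right, mul_one]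
  one_comp h x := by
    induction x using Finsupp.induction_linear with
    | zero => simp
    | add x y hx hy => rw [map_add, hx, hy]
    | single σ c => rw [asComp_single, permComp_one_left, one_mul]
  comp_assoc hp hr hq hr' i j a ha x y z := by
    induction x using Finsupp.induction_linear with
    | zero => simp
    | add x x' hx hx' => simp only [map_add, LinearMap.add_apply, hx, hx']
    | single σ c =>
      induction y using Finsupp.induction_linear with
      | zero => simp
      | add y y' hy hy' => simp only [map_add, LinearMap.add_apply, hy, hy']
      | single τ d =>
        induction z using Finsupp.induction_linear with
        | zero => simp
        | add z z' hz hz' => simp only [map_add, hz, hz']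
        | single ρ e =>
          simp only [asComp_single, permComp_assoc hp hr hq hr' i j a ha, mul_assoc]
  comp_comm hp hr hq hr' i k hik a ha b hb x y z := by
    induction x using Finsupp.induction_linear with
    | zero => simp
    | add x x' hx hx' => simp only [map_add, LinearMap.add_apply, hx, hx']
    | single σ c =>
      induction y using Finsupp.induction_linear with
      | zero => simp
      | add y y' hy hy' => simp only [map_add, LinearMap.add_apply, hy, hy']
      | single τ d =>
        induction z using Finsupp.induction_linear with
        | zero => simp
        | add z z' hz hz' => simp only [map_add, LinearMap.add_apply, hz, hz']
        | single ρ e =>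
          simp only [asComp_single, permComp_comm hp hr hq hr' i k hik a ha b hb, mul_assoc,
            mul_comm d e]
  comp_act_right h i x y σ := by
    induction x using Finsupp.induction_linear with
    | zero => simp
    | add x x' hx hx' => simp only [map_add, LinearMap.add_apply, hx, hx']
    | single τ c =>
      induction y using Finsupp.induction_linear with
      | zero => simp
      | add y y' hy hy' => simp only [map_add, hy, hy']
      | single ρ d =>
        have := permComp_mul h i τ 1 ρ σ
        simp only [mul_one, Equiv.Perm.coe_one, id] at this
        simp only [asComp_single, asAct_single, this]
  comp_act_left h i x y φ := by
    induction x using Finsupp.induction_linear with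
    | zero => simp
    | add x x' hx hx' => simp only [map_add, LinearMap.add_apply, hx, hx']
    | single τ c =>
      induction y using Finsupp.induction_linear with
      | zero => simp
      | add y y' hy hy' => simp only [map_add, hy, hy']
      | single ρ d =>
        have := permComp_mul h i τ φ ρ 1
        simp only [mul_one] at this
        simp only [asComp_single, asAct_single, this]

/-! ## Ideals and quotients -/

section Quotient

variable {R : Type u} [CommRing R] {M : ℕ → Type v} [∀ n, AddCommGroup (M n)]
  [∀ n, Module R (M n)]

/-- An operadic ideal: a sequence of submodules that is stable under the symmetric groups and
absorbs partial compositions on both sides. -/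
structure OperadStructure.IsIdeal (O : OperadStructure R M) (I : ∀ n, Submodule R (M n)) :
    Prop where
  act_mem : ∀ {n : ℕ} (σ : Equiv.Perm (Fin n)) (x : M n), x ∈ I n → O.act σ x ∈ I n
  comp_mem_left : ∀ {m n k : ℕ} (h : m + n = k + 1) (i : Fin m) (x : M m) (y : M n),
    x ∈ I m → O.comp h i x y ∈ I k
  comp_mem_right : ∀ {m n k : ℕ} (h : m + n = k + 1) (i : Fin m) (x : M m) (y : M n),
    y ∈ I n → O.comp h i x y ∈ I k

/-- The partial composition induced on the quotients by an ideal: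
`[x] ∘_i [y] = [x ∘_i y]`. -/
def OperadStructure.quotientComp (O : OperadStructure R M) {I : ∀ n, Submodule R (M n)}
    (hI : O.IsIdeal I) {m n k : ℕ} (h : m + n = k + 1) (i : Fin m) :
    (M m ⧸ I m) →ₗ[R] (M n ⧸ I n) →ₗ[R] (M k ⧸ I k) :=
  (I m).liftQ
    ((I n).liftQ ((O.comp h i).compr₂ (I k).mkQ).flip (by
      intro y hy
      rw [LinearMap.mem_ker]
      ext x
      simpa using hI.comp_mem_right h i x y hy)).flip (by
    intro x hx
    rw [LinearMap.mem_ker]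
    ext y
    simpa using hI.comp_mem_left h i x y hx)

theorem OperadStructure.quotientComp_mk (O : OperadStructure R M)
    {I : ∀ n, Submodule R (M n)} (hI : O.IsIdeal I) {m n k : ℕ} (h : m + n = k + 1)
    (i : Fin m) (x : M m) (y : M n) :
    O.quotientComp hI h i (Submodule.Quotient.mk x) (Submodule.Quotient.mk y) =
      Submodule.Quotient.mk (O.comp h i x y) := rfl

/-- The quotient operad `P/I`, with `(P/I)(n) = P(n)/I(n)`. -/
def OperadStructure.quotient (O : OperadStructure R M) {I : ∀ n, Submodule R (M n)}
    (hI : O.IsIdeal I) : OperadStructure R (fun n => M n ⧸ I n) where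
  one := Submodule.Quotient.mk O.one
  act {n} σ := (I n).mapQ (I n) (O.act σ) (fun x hx => hI.act_mem σ x hx)
  comp h i := O.quotientComp hI h i
  act_one x := by
    obtain ⟨x, rfl⟩ := Submodule.Quotient.mk_surjective _ x
    simp [O.act_one]
  act_mul σ τ x := by
    obtain ⟨x, rfl⟩ := Submodule.Quotient.mk_surjective _ x
    simp [O.act_mul]
  comp_one h i x := by
    obtain ⟨x, rfl⟩ := Submodule.Quotient.mk_surjective _ x
    rw [O.quotientComp_mk, O.comp_one]
  one_comp h x := by
    obtain ⟨x, rfl⟩ := Submodule.Quotient.mk_surjective _ x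
    rw [O.quotientComp_mk, O.one_comp]
  comp_assoc hp hr hq hr' i j a ha x y z := by
    obtain ⟨x, rfl⟩ := Submodule.Quotient.mk_surjective _ x
    obtain ⟨y, rfl⟩ := Submodule.Quotient.mk_surjective _ y
    obtain ⟨z, rfl⟩ := Submodule.Quotient.mk_surjective _ z
    simp only [O.quotientComp_mk, O.comp_assoc hp hr hq hr' i j a ha]
  comp_comm hp hr hq hr' i k hik a ha b hb x y z := by
    obtain ⟨x, rfl⟩ := Submodule.Quotient.mk_surjective _ x
    obtain ⟨y, rfl⟩ := Submodule.Quotient.mk_surjective _ y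
    obtain ⟨z, rfl⟩ := Submodule.Quotient.mk_surjective _ z
    simp only [O.quotientComp_mk, O.comp_comm hp hr hq hr' i k hik a ha b hb]
  comp_act_right h i x y σ := by
    obtain ⟨x, rfl⟩ := Submodule.Quotient.mk_surjective _ x
    obtain ⟨y, rfl⟩ := Submodule.Quotient.mk_surjective _ y
    simp only [O.quotientComp_mk, Submodule.mapQ_apply, O.comp_act_right]
  comp_act_left h i x y φ := by
    obtain ⟨x, rfl⟩ := Submodule.Quotient.mk_surjective _ x
    obtain ⟨y, rfl⟩ := Submodule.Quotient.mk_surjective _ y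
    simp only [O.quotientComp_mk, Submodule.mapQ_apply, O.comp_act_left]

end Quotient

/-! ## Truncation ideals of a unitary operad -/

section Truncation

variable {R : Type u} [CommRing R] {M : ℕ → Type v} [∀ n, AddCommGroup (M n)]
  [∀ n, Module R (M n)]

/-- The arity reached from arity `m` by filling the slots `j - 1, …, 0` with elements of arities
`a (j - 1), …, a 0`. -/
def fillArity (a : ℕ → ℕ) : ℕ → ℕ → ℕ
  | 0, m => m
  | j + 1, m => fillArity a j (m + a j - 1)

/-- Fills the slots `j - 1, …, 0` of an operation of arity `m ≥ j` with `ν (j - 1), …, ν 0`,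
starting with the last one, so that the numbers of the slots still to be filled do not change. -/
def OperadStructure.fillSlots (O : OperadStructure R M) (a : ℕ → ℕ) (ν : ∀ i, M (a i)) :
    ∀ (j m : ℕ), j ≤ m → (M m →ₗ[R] M (fillArity a j m))
  | 0, _, _ => LinearMap.id
  | j + 1, m, hj =>
      (O.fillSlots a ν j (m + a j - 1) (by omega)).comp
        ((O.comp (k := m + a j - 1) (by omega) ⟨j, by omega⟩).flip (ν j))

/-- The total composition `θ ↦ θ ∘ (ν 0, …, ν (n - 1))` on operations `θ` of arity `n`. -/
def OperadStructure.totalComp (O : OperadStructure R M) (a : ℕ → ℕ) (ν : ∀ i, M (a i)) (n : ℕ) :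
    M n →ₗ[R] M (fillArity a n n) :=
  O.fillSlots a ν n n le_rfl

/-- `1_χ` for `χ ∈ {0, 1}`: the identity `1_1 = 1` and the `0`-unit `1_0 = u`. -/
def OperadStructure.unitElt (O : OperadStructure R M) (u : M 0) : ∀ b : Bool, M b.toNat
  | true => O.one
  | false => u

/-- The restriction operator `π^I(θ) = θ ∘ (1_{χ_I(0)}, …, 1_{χ_I(n-1)})` on operations of arity
`n`, for a set `I ⊆ {0, …, n - 1}` with characteristic function `χ_I`. -/
def OperadStructure.restriction (O : OperadStructure R M) (u : M 0) (I : Finset ℕ) (n : ℕ) :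
    M n →ₗ[R] M (fillArity (fun i => (decide (i ∈ I)).toNat) n n) :=
  O.totalComp (fun i => (decide (i ∈ I)).toNat) (fun i => O.unitElt u (decide (i ∈ I))) n

/-- The `k`-th truncation ideal: for `k ≥ 1`, it is the intersection of the kernels of the
restriction operators `π^I`, `|I| = k - 1`, in arities `n ≥ k`, and `0` in arities `n < k`; for
`k = 0` it is everything. -/
def OperadStructure.truncIdeal (O : OperadStructure R M) (u : M 0) (k n : ℕ) :
    Submodule R (M n) :=
  if k = 0 then ⊤
  else if n < k then ⊥
  else ⨅ I ∈ (Finset.range n).powersetCard (k - 1), LinearMap.ker (O.restriction u I n)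

/-! The truncation ideals are ideals. -/

/-- The family `1_χ` for a sequence of bits `χ`. -/
abbrev OperadStructure.fillBits (O : OperadStructure R M) (u : M 0) (χ : ℕ → Bool) (j m : ℕ)
    (h : j ≤ m) : M m →ₗ[R] M (fillArity (fun i => (χ i).toNat) j m) :=
  O.fillSlots (fun i => (χ i).toNat) (fun i => O.unitElt u (χ i)) j m h

theorem OperadStructure.fillBits_succ (O : OperadStructure R M) (u : M 0) (χ : ℕ → Bool)
    (j m m' : ℕ) (h : j + 1 ≤ m) (b : Bool) (hb : χ j = b) (hm : m + b.toNat = m' + 1) (x : M m) :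
    O.fillBits u χ (j + 1) m h x = 0 ↔
      O.fillBits u χ j m' (by omega) (O.comp hm ⟨j, by omega⟩ x (O.unitElt u b)) = 0 := by
  subst hb
  obtain rfl : m' = m + (χ j).toNat - 1 := by omega
  exact Iff.rfl

theorem OperadStructure.fillBits_congr (O : OperadStructure R M) (u : M 0) (χ χ' : ℕ → Bool)
    (j : ℕ) (hχ : ∀ i < j, χ i = χ' i) (m : ℕ) (h : j ≤ m) (x : M m) :
    O.fillBits u χ j m h x = 0 ↔ O.fillBits u χ' j m h x = 0 := by
  induction j generalizing m with
  | zero => exact Iff.rfl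
  | succ j ih =>
    have hm : m + (χ j).toNat = (m + (χ j).toNat - 1) + 1 := by omega
    rw [O.fillBits_succ u χ j m _ h (χ j) rfl hm,
      O.fillBits_succ u χ' j m _ h (χ j) (hχ j (by omega)).symm hm]
    exact ih (fun i hi => hχ i (by omega)) _ _ _

theorem OperadStructure.fillBits_true (O : OperadStructure R M) (u : M 0) (χ : ℕ → Bool)
    (j : ℕ) (hχ : ∀ i < j, χ i = true) (m : ℕ) (h : j ≤ m) (x : M m) :
    O.fillBits u χ j m h x = 0 ↔ x = 0 := by
  induction j with
  | zero => exact Iff.rfl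
  | succ j ih =>
    rw [O.fillBits_succ u χ j m m h true (hχ j (by omega)) rfl]
    have e : O.comp (m := m) (n := 1) (k := m) rfl ⟨j, by omega⟩ x (O.unitElt u true) = x :=
      O.comp_one rfl ⟨j, by omega⟩ x
    rw [show O.comp (m := m) (n := true.toNat) (k := m) rfl ⟨j, by omega⟩ x (O.unitElt u true) = x
      from e]
    exact ih (fun i hi => hχ i (by omega)) _

/-- Removing a `0` from the bits amounts to composing with the `0`-unit first. -/
theorem OperadStructure.fillBits_skip (O : OperadStructure R M) (u : M 0) (N : ℕ) :
    ∀ (j : ℕ) (_ : j ≤ N) (χ χ' : ℕ → Bool) (_ : χ j = false) (_ : ∀ i < j, χ' i = χ i)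
      (_ : ∀ i, j ≤ i → χ' i = χ (i + 1)) (m m' : ℕ) (hm : m + 0 = m' + 1) (hN : N + 1 ≤ m)
      (x : M m),
      O.fillBits u χ (N + 1) m hN x = 0 ↔
        O.fillBits u χ' N m' (by omega) (O.comp hm ⟨j, by omega⟩ x u) = 0 := by
  induction N with
  | zero =>
    intro j hj χ χ' h0 h1 h2 m m' hm hN x
    obtain rfl : j = 0 := by omega
    rw [O.fillBits_succ u χ 0 m m' hN false h0 hm]
    exact Iff.rfl
  | succ N ih =>
    intro j hj χ χ' h0 h1 h2 m m' hm hN x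
    rcases Nat.lt_or_ge j (N + 1) with hlt | hge
    · have hb : χ' N = χ (N + 1) := h2 N (by omega)
      have hm1 : m + (χ (N + 1)).toNat = (m + (χ (N + 1)).toNat - 1) + 1 := by omega
      have hm2 : m' + (χ (N + 1)).toNat = (m' + (χ (N + 1)).toNat - 1) + 1 := by omega
      have hm3 : (m + (χ (N + 1)).toNat - 1) + 0 = (m' + (χ (N + 1)).toNat - 1) + 1 := by omega
      rw [O.fillBits_succ u χ (N + 1) m _ hN (χ (N + 1)) rfl hm1,
        O.fillBits_succ u χ' N m' _ (by omega) (χ (N + 1)) hb hm2,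
        ih j (by omega) χ χ' h0 h1 h2 _ _ hm3 (by omega)]
      rw [O.comp_comm hm hm2 hm1 hm3 ⟨j, by omega⟩ ⟨N + 1, by omega⟩ (by
          rw [Fin.lt_def]; exact hlt) ⟨N, by omega⟩ rfl ⟨j, by omega⟩ rfl]
    · obtain rfl : j = N + 1 := by omega
      rw [O.fillBits_succ u χ (N + 1) m m' hN false h0 hm]
      exact O.fillBits_congr u χ χ' (N + 1) (fun i hi => (h1 i hi).symm) _ _ _

/-- All restrictions to `s` inputs vanish. -/
def OperadStructure.Vanish (O : OperadStructure R M) (u : M 0) (s n : ℕ) (x : M n) : Prop :=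
  ∀ I ∈ (Finset.range n).powersetCard s, O.restriction u I n x = 0

theorem OperadStructure.vanish_self (O : OperadStructure R M) (u : M 0) (n : ℕ) (x : M n) :
    O.Vanish u n n x ↔ x = 0 := by
  have : (Finset.range n).powersetCard n = {Finset.range n} := by
    conv_lhs => rw [show n = (Finset.range n).card from (Finset.card_range n).symm]
    rw [Finset.card_range]
    exact (by simpa using Finset.powersetCard_self (Finset.range n))
  simp only [OperadStructure.Vanish, this, Finset.mem_singleton, forall_eq]
  exact O.fillBits_true u (fun i => decide (i ∈ Finset.range n)) n
    (fun i hi => by simpa using hi) n le_rfl x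

theorem OperadStructure.vanish_succ (O : OperadStructure R M) (u : M 0) (s n : ℕ) (hs : s ≤ n)
    (x : M (n + 1)) :
    O.Vanish u s (n + 1) x ↔
      ∀ j : Fin (n + 1), O.Vanish u s n (O.comp (m := n + 1) (n := 0) (k := n) rfl j x u) := by
  constructor
  · intro hx j I hI
    rw [Finset.mem_powersetCard] at hI
    let f : ℕ → ℕ := fun i => if i < (j : ℕ) then i else i + 1
    have hf : Function.Injective f := by
      intro a b hab
      simp only [f] at hab
      split_ifs at hab <;> omega
    have hJ : I.image f ∈ (Finset.range (n + 1)).powersetCard s := by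
      rw [Finset.mem_powersetCard, Finset.card_image_of_injective _ hf]
      refine ⟨fun a ha => ?_, hI.2⟩
      obtain ⟨i, hi, rfl⟩ := Finset.mem_image.1 ha
      have := Finset.mem_range.1 (hI.1 hi)
      simp only [f, Finset.mem_range]
      split_ifs <;> omega
    refine (O.fillBits_skip u n j (by omega) (fun i => decide (i ∈ I.image f))
      (fun i => decide (i ∈ I)) ?_ ?_ ?_ (n + 1) n rfl le_rfl x).1 (hx _ hJ)
    · simp only [decide_eq_false_iff_not, Finset.mem_image, not_exists, not_and, f]
      intro i _ h
      split_ifs at h <;> omega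
    · intro i hi
      have : f i = i := if_pos hi
      simp only [decide_eq_decide]
      conv_rhs => rw [← this]
      rw [hf.mem_finset_image]
    · intro i hi
      have : f i = i + 1 := if_neg (by omega)
      simp only [decide_eq_decide]
      rw [← this, hf.mem_finset_image]
  · intro hx I hI
    rw [Finset.mem_powersetCard] at hI
    obtain ⟨j, hj, hjI⟩ : ∃ j ∈ Finset.range (n + 1), j ∉ I := by
      by_contra hcon
      push Not at hcon
      have := Finset.card_le_card (show Finset.range (n + 1) ⊆ I from hcon)
      rw [Finset.card_range, hI.2] at this
      omega
    have hj' := Finset.mem_range.1 hj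
    let f : ℕ → ℕ := fun i => if i < j then i else i + 1
    have hf : Function.Injective f := by
      intro a b hab
      simp only [f] at hab
      split_ifs at hab <;> omega
    let J : Finset ℕ := (Finset.range n).filter (fun i => f i ∈ I)
    have hJI : J.image f = I := by
      ext a
      simp only [J, Finset.mem_image, Finset.mem_filter, Finset.mem_range]
      constructor
      · rintro ⟨i, ⟨_, hi⟩, rfl⟩
        exact hi
      · intro ha
        have h1 := Finset.mem_range.1 (hI.1 ha)
        have h2 : a ≠ j := fun e => hjI (e ▸ ha)
        rcases Nat.lt_or_ge a j with h | h
        · have : f a = a := if_pos h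
          exact ⟨a, ⟨by omega, by rwa [this]⟩, this⟩
        · have : f (a - 1) = a := by
            simp only [f]
            rw [if_neg (by omega)]
            omega
          exact ⟨a - 1, ⟨by omega, by rwa [this]⟩, this⟩
    have hJ : J ∈ (Finset.range n).powersetCard s := by
      rw [Finset.mem_powersetCard]
      refine ⟨Finset.filter_subset _ _, ?_⟩
      rw [← hI.2, ← hJI, Finset.card_image_of_injective _ hf]
    have hmem : ∀ i, f i ∈ I ↔ i ∈ J := by
      intro i
      rw [← hJI, hf.mem_finset_image]
    refine (O.fillBits_skip u n j (by omega) (fun i => decide (i ∈ I))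
      (fun i => decide (i ∈ J)) (by simpa using hjI) ?_ ?_ (n + 1) n rfl le_rfl x).2
      (hx ⟨j, hj'⟩ J hJ)
    · intro i hi
      have : f i = i := if_pos hi
      simp only [decide_eq_decide]
      rw [← hmem i, this]
    · intro i hi
      have : f i = i + 1 := if_neg (by omega)
      simp only [decide_eq_decide]
      rw [← hmem i, this]

theorem OperadStructure.mem_truncIdeal_of_lt (O : OperadStructure R M) (u : M 0) {k n : ℕ}
    (hn : n < k) (x : M n) : x ∈ O.truncIdeal u k n ↔ x = 0 := by
  rw [OperadStructure.truncIdeal, if_neg (by omega), if_pos hn, Submodule.mem_bot]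

theorem OperadStructure.mem_truncIdeal_iff_vanish (O : OperadStructure R M) (u : M 0) {k n : ℕ}
    (hk : 1 ≤ k) (hn : k - 1 ≤ n) (x : M n) :
    x ∈ O.truncIdeal u k n ↔ O.Vanish u (k - 1) n x := by
  rcases Nat.lt_or_ge n k with h | h
  · obtain rfl : n = k - 1 := by omega
    rw [O.mem_truncIdeal_of_lt u h, O.vanish_self]
  · rw [OperadStructure.truncIdeal, if_neg (by omega), if_neg (by omega)]
    simp only [Submodule.mem_iInf, LinearMap.mem_ker]
    exact Iff.rfl

/-- In arities `n + 1 ≥ k ≥ 1`, an element lies in the `k`-th truncation ideal if and only if all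
its partial compositions with the `0`-unit do. -/
theorem OperadStructure.mem_truncIdeal_succ (O : OperadStructure R M) (u : M 0) {k n : ℕ}
    (hk : 1 ≤ k) (hn : k ≤ n + 1) (x : M (n + 1)) :
    x ∈ O.truncIdeal u k (n + 1) ↔
      ∀ j : Fin (n + 1), O.comp (m := n + 1) (n := 0) (k := n) rfl j x u ∈ O.truncIdeal u k n := by
  rw [O.mem_truncIdeal_iff_vanish u hk (by omega), O.vanish_succ u _ _ (by omega)]
  exact forall_congr' fun j => (O.mem_truncIdeal_iff_vanish u hk (by omega) _).symm

theorem OperadStructure.comp_unit_mem_truncIdeal (O : OperadStructure R M) (u : M 0) {k m n : ℕ}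
    (h : m + 0 = n + 1) (j : Fin m) (x : M m) (hx : x ∈ O.truncIdeal u k m) :
    O.comp h j x u ∈ O.truncIdeal u k n := by
  obtain rfl : m = n + 1 := by omega
  rcases Nat.eq_zero_or_pos k with rfl | hk
  · simp [OperadStructure.truncIdeal]
  rcases Nat.lt_or_ge (n + 1) k with h1 | h1
  · rw [O.mem_truncIdeal_of_lt u h1] at hx
    rw [hx, map_zero, LinearMap.zero_apply]
    exact zero_mem _
  · exact (O.mem_truncIdeal_succ u hk h1 x).1 hx j

/-- The truncation ideals of a unitary operad (that is, `P(0)` is spanned by `u`) are ideals. -/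
theorem OperadStructure.truncIdeal_isIdeal (O : OperadStructure R M) (u : M 0)
    (hu : ∀ x : M 0, ∃ c : R, x = c • u) (k : ℕ) : O.IsIdeal (O.truncIdeal u k) := by
  rcases Nat.eq_zero_or_pos k with rfl | hk
  · constructor <;> intros <;> simp [OperadStructure.truncIdeal]
  constructor
  · intro n
    induction n with
    | zero =>
      intro σ x hx
      obtain rfl : σ = 1 := Subsingleton.elim _ _
      rwa [O.act_one]
    | succ n ih =>
      intro σ x hx
      rcases Nat.lt_or_ge (n + 1) k with h | h
      · rw [O.mem_truncIdeal_of_lt u h] at hx ⊢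
        rw [hx, map_zero]
      · rw [O.mem_truncIdeal_succ u hk h]
        intro j
        rw [O.comp_act_left]
        exact ih _ _ (O.comp_unit_mem_truncIdeal u rfl _ x hx)
  · intro m n r h i x y hx
    induction r generalizing m n with
    | zero =>
      rcases Nat.lt_or_ge m k with h1 | h1
      · rw [O.mem_truncIdeal_of_lt u h1] at hx
        rw [hx, map_zero, LinearMap.zero_apply]
        exact zero_mem _
      · have hi := i.isLt
        obtain rfl : n = 0 := by omega
        obtain ⟨c, rfl⟩ := hu y
        rw [map_smul]
        exact Submodule.smul_mem _ _ (O.comp_unit_mem_truncIdeal u h i x hx)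
    | succ r ih =>
      rcases Nat.lt_or_ge m k with h1 | h1
      · rw [O.mem_truncIdeal_of_lt u h1] at hx
        rw [hx, map_zero, LinearMap.zero_apply]
        exact zero_mem _
      · rcases Nat.eq_zero_or_pos n with rfl | hn
        · obtain ⟨c, rfl⟩ := hu y
          rw [map_smul]
          exact Submodule.smul_mem _ _ (O.comp_unit_mem_truncIdeal u h i x hx)
        · rw [O.mem_truncIdeal_succ u hk (by omega)]
          intro a
          have hi := i.isLt
          have ha := a.isLt
          rcases Nat.lt_or_ge (a : ℕ) i with h2 | h2
          · rw [← O.comp_comm (p := m - 1) (l := m) (m := 0) (n := n) (q := r + 1) (r := r) (by omega)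
              (by omega) h rfl ⟨a, by omega⟩ i
              (by rw [Fin.lt_def]; exact h2) ⟨i - 1, by omega⟩ (by simp only; omega) a rfl]
            exact ih _ _ _ _ (O.comp_unit_mem_truncIdeal u _ _ x hx)
          · rcases Nat.lt_or_ge (a : ℕ) (i + n) with h3 | h3
            · rw [O.comp_assoc (n := 0) (r := r) h rfl (q := n - 1) (by omega) (by omega) i ⟨a - i, by omega⟩ a
                (by simp only; omega)]
              exact ih _ _ _ _ hx
            · rw [O.comp_comm (n := 0) (r := r) h rfl (q := m - 1) (by omega) (by omega) i ⟨a + 1 - n, by omega⟩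
                (by rw [Fin.lt_def]; simp only; omega) a (by simp only; omega) ⟨i, by omega⟩ rfl]
              exact ih _ _ _ _ (O.comp_unit_mem_truncIdeal u _ _ x hx)
  · intro m n r h i x y hy
    induction r generalizing m n with
    | zero =>
      rcases Nat.lt_or_ge n k with h1 | h1
      · rw [O.mem_truncIdeal_of_lt u h1] at hy
        rw [hy, map_zero]
        exact zero_mem _
      · have hi := i.isLt
        obtain rfl : m = 1 := by omega
        obtain rfl : n = 0 := by omega
        omega
    | succ r ih =>
      rcases Nat.lt_or_ge n k with h1 | h1
      · rw [O.mem_truncIdeal_of_lt u h1] at hy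
        rw [hy, map_zero]
        exact zero_mem _
      · have hi := i.isLt
        rw [O.mem_truncIdeal_succ u hk (by omega)]
        intro a
        have ha := a.isLt
        rcases Nat.lt_or_ge (a : ℕ) i with h2 | h2
        · rw [← O.comp_comm (p := m - 1) (l := m) (m := 0) (n := n) (q := r + 1) (r := r) (by omega)
              (by omega) h rfl ⟨a, by omega⟩ i
            (by rw [Fin.lt_def]; exact h2) ⟨i - 1, by omega⟩ (by simp only; omega) a rfl]
          exact ih _ _ _ _ hy
        · rcases Nat.lt_or_ge (a : ℕ) (i + n) with h3 | h3
          · rw [O.comp_assoc (n := 0) (r := r) h rfl (q := n - 1) (by omega) (by omega) i ⟨a - i, by omega⟩ a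
              (by simp only; omega)]
            exact ih _ _ _ _ (O.comp_unit_mem_truncIdeal u _ _ y hy)
          · rw [O.comp_comm (n := 0) (r := r) h rfl (q := m - 1) (by omega) (by omega) i ⟨a + 1 - n, by omega⟩
              (by rw [Fin.lt_def]; simp only; omega) a (by simp only; omega) ⟨i, by omega⟩ rfl]
            exact ih _ _ _ _ hy

end Truncation

/-- The `0`-unit `1_0 ∈ S_0` of `As`. -/
noncomputable def asUnit (R : Type u) [CommRing R] : Equiv.Perm (Fin 0) →₀ R :=
  Finsupp.single 1 1

theorem asUnit_spans (R : Type u) [CommRing R] (x : Equiv.Perm (Fin 0) →₀ R) :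
    ∃ c : R, x = c • asUnit R := by
  refine ⟨x 1, Finsupp.ext fun σ => ?_⟩
  obtain rfl : σ = 1 := Subsingleton.elim _ _
  simp [asUnit]

/-- The underlying modules of the truncation `As/ᵏI`. -/
abbrev AsTruncModule (R : Type u) [CommRing R] (k n : ℕ) : Type u :=
  (Equiv.Perm (Fin n) →₀ R) ⧸ (asOperad R).truncIdeal (asUnit R) k n

/-- The truncation `As/ᵏI` of the operad `As` by its `k`-th truncation ideal. -/
noncomputable def asTrunc (R : Type u) [CommRing R] (k : ℕ) :
    OperadStructure R (AsTruncModule R k) :=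
  (asOperad R).quotient ((asOperad R).truncIdeal_isIdeal (asUnit R) (asUnit_spans R) k)

/-! ## Second cohomology -/

/-- The index set of the partial compositions: arities `m`, `n`, `k` with `m + n = k + 1`, and a
slot `i` of the first operation. -/
structure CompIndex where
  m : ℕ
  n : ℕ
  k : ℕ
  arity : m + n = k + 1
  i : Fin m

section Cohomology

variable {R : Type u} [CommRing R] {M : ℕ → Type v} [∀ n, AddCommGroup (M n)]
  [∀ n, Module R (M n)]

/-- The module of `℘ς`-collections: bilinear maps `℘_i : M m ⊗ M n → M (m + n - 1)`, one for each
partial composition, together with linear maps `ς_m : M m ⊗ R[S_m] → M m`; since `S_m` is a basis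
of `R[S_m]`, the latter are given as families of linear maps `x ↦ ς(x, σ)` indexed by `σ ∈ S_m`. -/
def WVCollection (R : Type u) [CommRing R] (M : ℕ → Type v) [∀ n, AddCommGroup (M n)]
    [∀ n, Module R (M n)] : Type v :=
  (∀ c : CompIndex, M c.m →ₗ[R] M c.n →ₗ[R] M c.k) ×
    (∀ m : ℕ, Equiv.Perm (Fin m) → (M m →ₗ[R] M m))

noncomputable instance : AddCommGroup (WVCollection R M) :=
  inferInstanceAs (AddCommGroup ((∀ c : CompIndex, M c.m →ₗ[R] M c.n →ₗ[R] M c.k) ×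
    (∀ m : ℕ, Equiv.Perm (Fin m) → (M m →ₗ[R] M m))))

noncomputable instance : Module R (WVCollection R M) :=
  inferInstanceAs (Module R ((∀ c : CompIndex, M c.m →ₗ[R] M c.n →ₗ[R] M c.k) ×
    (∀ m : ℕ, Equiv.Perm (Fin m) → (M m →ₗ[R] M m))))

/-- `w.wp h i x y` is `℘_i(x, y)`. -/
def WVCollection.wp (w : WVCollection R M) {m n k : ℕ} (h : m + n = k + 1) (i : Fin m) :
    M m →ₗ[R] M n →ₗ[R] M k :=
  w.1 ⟨m, n, k, h, i⟩

/-- `w.vs σ x` is `ς(x, σ)`. -/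
def WVCollection.vs (w : WVCollection R M) {m : ℕ} (σ : Equiv.Perm (Fin m)) : M m →ₗ[R] M m :=
  w.2 m σ

/-- The 2-cocycle conditions on a `℘ς`-collection. -/
structure OperadStructure.IsTwoCocycle (O : OperadStructure R M) (w : WVCollection R M) :
    Prop where
  assoc : ∀ {l m n p q r : ℕ} (hp : l + m = p + 1) (hr : p + n = r + 1)
    (hq : m + n = q + 1) (hr' : l + q = r + 1) (i : Fin l) (j : Fin m) (a : Fin p),
    (a : ℕ) = i + j → ∀ (x : M l) (y : M m) (z : M n),
    w.wp hr a (O.comp hp i x y) z + O.comp hr a (w.wp hp i x y) z =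
      w.wp hr' i x (O.comp hq j y z) + O.comp hr' i x (w.wp hq j y z)
  comm : ∀ {l m n p q r : ℕ} (hp : l + m = p + 1) (hr : p + n = r + 1)
    (hq : l + n = q + 1) (hr' : q + m = r + 1) (i k : Fin l), i < k →
    ∀ (a : Fin p), (a : ℕ) + 1 = k + m → ∀ (b : Fin q), (b : ℕ) = i →
    ∀ (x : M l) (y : M m) (z : M n),
    w.wp hr a (O.comp hp i x y) z + O.comp hr a (w.wp hp i x y) z =
      w.wp hr' b (O.comp hq k x z) y + O.comp hr' b (w.wp hq k x z) y
  act_right : ∀ {m n k : ℕ} (h : m + n = k + 1) (i : Fin m) (x : M m) (y : M n)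
    (σ : Equiv.Perm (Fin n)),
    w.wp h i x (O.act σ y) + O.comp h i x (w.vs σ y) =
      O.act (permComp h i 1 σ) (w.wp h i x y) + w.vs (permComp h i 1 σ) (O.comp h i x y)
  act_left : ∀ {m n k : ℕ} (h : m + n = k + 1) (i : Fin m) (x : M m) (y : M n)
    (φ : Equiv.Perm (Fin m)),
    w.wp h i (O.act φ x) y + O.comp h i (w.vs φ x) y =
      O.act (permComp h i φ 1) (w.wp h (φ i) x y) +
        w.vs (permComp h i φ 1) (O.comp h (φ i) x y)
  act_mul : ∀ {m : ℕ} (x : M m) (σ τ : Equiv.Perm (Fin m)),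
    w.vs (σ * τ) x = w.vs τ (O.act σ x) + O.act τ (w.vs σ x)

theorem WVCollection.wp_add (w w' : WVCollection R M) {m n k : ℕ} (h : m + n = k + 1)
    (i : Fin m) (x : M m) (y : M n) :
    WVCollection.wp (w + w') h i x y = w.wp h i x y + w'.wp h i x y := rfl

theorem WVCollection.vs_add (w w' : WVCollection R M) {m : ℕ} (σ : Equiv.Perm (Fin m))
    (x : M m) : WVCollection.vs (w + w') σ x = w.vs σ x + w'.vs σ x := rfl

theorem WVCollection.wp_smul (c : R) (w : WVCollection R M) {m n k : ℕ} (h : m + n = k + 1)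
    (i : Fin m) (x : M m) (y : M n) :
    WVCollection.wp (c • w) h i x y = c • w.wp h i x y := rfl

theorem WVCollection.vs_smul (c : R) (w : WVCollection R M) {m : ℕ} (σ : Equiv.Perm (Fin m))
    (x : M m) : WVCollection.vs (c • w) σ x = c • w.vs σ x := rfl

theorem WVCollection.wp_zero {m n k : ℕ} (h : m + n = k + 1) (i : Fin m) (x : M m) (y : M n) :
    WVCollection.wp (0 : WVCollection R M) h i x y = 0 := rfl

theorem WVCollection.vs_zero {m : ℕ} (σ : Equiv.Perm (Fin m)) (x : M m) :
    WVCollection.vs (0 : WVCollection R M) σ x = 0 := rfl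

/-- The module `Z²_*(P)` of 2-cocycles. -/
noncomputable def OperadStructure.Z2Star (O : OperadStructure R M) : Submodule R (WVCollection R M) where
  carrier := {w | O.IsTwoCocycle w}
  zero_mem' := by
    constructor <;> intros <;> simp [WVCollection.wp_zero, WVCollection.vs_zero]
  add_mem' {w w'} hw hw' := by
    constructor
    · intro l m n p q r hp hr hq hr' i j a ha x y z
      have h1 := hw.assoc hp hr hq hr' i j a ha x y z
      have h2 := hw'.assoc hp hr hq hr' i j a ha x y z
      simp only [WVCollection.wp_add, map_add, LinearMap.add_apply]
      rw [add_add_add_comm, h1, h2, add_add_add_comm]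
    · intro l m n p q r hp hr hq hr' i k hik a ha b hb x y z
      have h1 := hw.comm hp hr hq hr' i k hik a ha b hb x y z
      have h2 := hw'.comm hp hr hq hr' i k hik a ha b hb x y z
      simp only [WVCollection.wp_add, map_add, LinearMap.add_apply]
      rw [add_add_add_comm, h1, h2, add_add_add_comm]
    · intro m n k h i x y σ
      have h1 := hw.act_right h i x y σ
      have h2 := hw'.act_right h i x y σ
      simp only [WVCollection.wp_add, WVCollection.vs_add, map_add]
      rw [add_add_add_comm, h1, h2, add_add_add_comm]
    · intro m n k h i x y φ
      have h1 := hw.act_left h i x y φ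
      have h2 := hw'.act_left h i x y φ
      simp only [WVCollection.wp_add, WVCollection.vs_add, map_add, LinearMap.add_apply]
      rw [add_add_add_comm, h1, h2, add_add_add_comm]
    · intro m x σ τ
      have h1 := hw.act_mul x σ τ
      have h2 := hw'.act_mul x σ τ
      simp only [WVCollection.vs_add, map_add]
      rw [h1, h2, add_add_add_comm]
  smul_mem' c w hw := by
    constructor
    · intro l m n p q r hp hr hq hr' i j a ha x y z
      have h1 := hw.assoc hp hr hq hr' i j a ha x y z
      simp only [WVCollection.wp_smul, map_smul, LinearMap.smul_apply]
      rw [← smul_add, h1, smul_add]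
    · intro l m n p q r hp hr hq hr' i k hik a ha b hb x y z
      have h1 := hw.comm hp hr hq hr' i k hik a ha b hb x y z
      simp only [WVCollection.wp_smul, map_smul, LinearMap.smul_apply]
      rw [← smul_add, h1, smul_add]
    · intro m n k h i x y σ
      have h1 := hw.act_right h i x y σ
      simp only [WVCollection.wp_smul, WVCollection.vs_smul, map_smul]
      rw [← smul_add, h1, smul_add]
    · intro m n k h i x y φ
      have h1 := hw.act_left h i x y φ
      simp only [WVCollection.wp_smul, WVCollection.vs_smul, map_smul, LinearMap.smul_apply]
      rw [← smul_add, h1, smul_add]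
    · intro m x σ τ
      have h1 := hw.act_mul x σ τ
      simp only [WVCollection.vs_smul, map_smul]
      rw [h1, smul_add]

/-- The `℘ς`-collections with `ς = 0`. -/
noncomputable def symmetricCollections (R : Type u) [CommRing R] (M : ℕ → Type v) [∀ n, AddCommGroup (M n)]
    [∀ n, Module R (M n)] : Submodule R (WVCollection R M) where
  carrier := {w | ∀ (m : ℕ) (σ : Equiv.Perm (Fin m)) (x : M m), w.vs σ x = 0}
  zero_mem' _ _ _ := rfl
  add_mem' {w w'} hw hw' m σ x := by
    rw [WVCollection.vs_add, hw m σ x, hw' m σ x, add_zero]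
  smul_mem' c w hw m σ x := by
    rw [WVCollection.vs_smul, hw m σ x, smul_zero]

/-- The module `Z²(P)` of `S`-2-cocycles, that is, 2-cocycles with `ς = 0`. -/
noncomputable def OperadStructure.Z2 (O : OperadStructure R M) : Submodule R (WVCollection R M) :=
  O.Z2Star ⊓ symmetricCollections R M

/-- The `℘ς`-collection of an arity-preserving linear map `∂ : P → P`:
`℘_i(x, y) = ∂(x ∘_i y) - (∂x ∘_i y + x ∘_i ∂y)` and `ς(x, σ) = ∂(x * σ) - ∂x * σ`. -/
noncomputable def OperadStructure.coboundary (O : OperadStructure R M) (d : ∀ n, M n →ₗ[R] M n) :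
    WVCollection R M :=
  (fun c => (O.comp c.arity c.i).compr₂ (d c.k) -
      ((O.comp c.arity c.i).comp (d c.m) + (O.comp c.arity c.i).compl₂ (d c.n)),
    fun m σ => (d m).comp (O.act σ) - (O.act σ).comp (d m))

theorem OperadStructure.coboundary_wp (O : OperadStructure R M) (d : ∀ n, M n →ₗ[R] M n)
    {m n k : ℕ} (h : m + n = k + 1) (i : Fin m) (x : M m) (y : M n) :
    (O.coboundary d).wp h i x y =
      d k (O.comp h i x y) - (O.comp h i (d m x) y + O.comp h i x (d n y)) := rfl

theorem OperadStructure.coboundary_vs (O : OperadStructure R M) (d : ∀ n, M n →ₗ[R] M n)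
    {m : ℕ} (σ : Equiv.Perm (Fin m)) (x : M m) :
    (O.coboundary d).vs σ x = d m (O.act σ x) - O.act σ (d m x) := rfl

theorem WVCollection.ext {w w' : WVCollection R M}
    (h1 : ∀ {m n k : ℕ} (h : m + n = k + 1) (i : Fin m) (x : M m) (y : M n),
      w.wp h i x y = w'.wp h i x y)
    (h2 : ∀ {m : ℕ} (σ : Equiv.Perm (Fin m)) (x : M m), w.vs σ x = w'.vs σ x) : w = w' := by
  refine Prod.ext ?_ ?_
  · funext c
    exact LinearMap.ext fun x => LinearMap.ext fun y => h1 c.arity c.i x y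
  · funext m σ
    exact LinearMap.ext fun x => h2 σ x

/-- The module `B²_*(P)` of 2-coboundaries. -/
noncomputable def OperadStructure.B2Star (O : OperadStructure R M) : Submodule R (WVCollection R M) where
  carrier := {w | ∃ d : ∀ n, M n →ₗ[R] M n, w = O.coboundary d}
  zero_mem' := by
    refine ⟨fun _ => 0, WVCollection.ext ?_ ?_⟩
    · intro m n k h i x y
      simp [O.coboundary_wp, WVCollection.wp_zero]
    · intro m σ x
      simp [O.coboundary_vs, WVCollection.vs_zero]
  add_mem' := by
    rintro _ _ ⟨d, rfl⟩ ⟨d', rfl⟩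
    refine ⟨fun n => d n + d' n, WVCollection.ext ?_ ?_⟩
    · intro m n k h i x y
      simp only [WVCollection.wp_add, O.coboundary_wp, LinearMap.add_apply, map_add]
      abel
    · intro m σ x
      simp only [WVCollection.vs_add, O.coboundary_vs, LinearMap.add_apply, map_add]
      abel
  smul_mem' := by
    rintro c _ ⟨d, rfl⟩
    refine ⟨fun n => c • d n, WVCollection.ext ?_ ?_⟩
    · intro m n k h i x y
      simp only [WVCollection.wp_smul, O.coboundary_wp, LinearMap.smul_apply, map_smul, smul_sub,
        smul_add]
    · intro m σ x
      simp only [WVCollection.vs_smul, O.coboundary_vs, LinearMap.smul_apply, map_smul, smul_sub]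

/-- The module `B²(P)` of `S`-2-coboundaries, that is, 2-coboundaries with `ς = 0`. -/
noncomputable def OperadStructure.B2 (O : OperadStructure R M) : Submodule R (WVCollection R M) :=
  O.B2Star ⊓ symmetricCollections R M

/-- Every 2-coboundary is a 2-cocycle. -/
theorem OperadStructure.B2Star_le_Z2Star (O : OperadStructure R M) : O.B2Star ≤ O.Z2Star := by
  rintro _ ⟨d, rfl⟩
  constructor
  · intro l m n p q r hp hr hq hr' i j a ha x y z
    simp only [O.coboundary_wp, map_add, map_sub, LinearMap.add_apply, LinearMap.sub_apply,
      O.comp_assoc hp hr hq hr' i j a ha]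
    abel
  · intro l m n p q r hp hr hq hr' i k hik a ha b hb x y z
    simp only [O.coboundary_wp, map_add, map_sub, LinearMap.add_apply, LinearMap.sub_apply,
      O.comp_comm hp hr hq hr' i k hik a ha b hb]
    abel
  · intro m n k h i x y σ
    simp only [O.coboundary_wp, O.coboundary_vs, map_add, map_sub, O.comp_act_right]
    abel
  · intro m n k h i x y φ
    simp only [O.coboundary_wp, O.coboundary_vs, map_add, map_sub, LinearMap.sub_apply,
      O.comp_act_left]
    abel
  · intro m x σ τ
    simp only [O.coboundary_vs, map_sub, O.act_mul]
    abel

/-- The second cohomology `H²_*(P) = Z²_*(P) / B²_*(P)`. -/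
abbrev OperadStructure.H2Star (O : OperadStructure R M) : Type v :=
  O.Z2Star ⧸ O.B2Star.submoduleOf O.Z2Star

/-- The second `S`-cohomology `H²(P) = Z²(P) / B²(P)`. -/
abbrev OperadStructure.H2 (O : OperadStructure R M) : Type v :=
  O.Z2 ⧸ O.B2.submoduleOf O.Z2

/-! ## Infinitesimal deformations -/

/-- An infinitesimal deformation of an operad `P` over `R`: an `R[ε]`-linear operad structure on
`P[ε] = R[ε] ⊗ P`, `ε² = 0`, with the same identity, such that
`x ∘_i^ε y = x ∘_i y + ℘_i(x, y) ε` and `x *^ε σ = x * σ + ς(x, σ) ε` for all `x`, `y` in `P`. -/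
structure InfinitesimalDeformation (O : OperadStructure R M) where
  toOperad : OperadStructure (DualNumber R) (fun n => DualNumber R ⊗[R] M n)
  collection : WVCollection R M
  one_eq : toOperad.one = 1 ⊗ₜ[R] O.one
  comp_eq : ∀ {m n k : ℕ} (h : m + n = k + 1) (i : Fin m) (x : M m) (y : M n),
    toOperad.comp h i (1 ⊗ₜ[R] x) (1 ⊗ₜ[R] y) =
      1 ⊗ₜ[R] O.comp h i x y + DualNumber.eps ⊗ₜ[R] collection.wp h i x y
  act_eq : ∀ {m : ℕ} (σ : Equiv.Perm (Fin m)) (x : M m),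
    toOperad.act σ (1 ⊗ₜ[R] x) = 1 ⊗ₜ[R] O.act σ x + DualNumber.eps ⊗ₜ[R] collection.vs σ x

/-- Two infinitesimal deformations are equivalent if there is an `R[ε]`-linear isomorphism of
operads `Φ` from the first to the second of the form `Φ(x) = x + ∂(x) ε`, `x ∈ P`, for an
(arity-preserving) `R`-linear map `∂ : P → P`. -/
def InfinitesimalDeformation.Equivalent {O : OperadStructure R M}
    (D D' : InfinitesimalDeformation O) : Prop :=
  ∃ Φ : ∀ n, (DualNumber R ⊗[R] M n) ≃ₗ[DualNumber R] (DualNumber R ⊗[R] M n),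
    Φ 1 D.toOperad.one = D'.toOperad.one ∧
    (∀ {n : ℕ} (σ : Equiv.Perm (Fin n)) (x : DualNumber R ⊗[R] M n),
      Φ n (D.toOperad.act σ x) = D'.toOperad.act σ (Φ n x)) ∧
    (∀ {m n k : ℕ} (h : m + n = k + 1) (i : Fin m) (x : DualNumber R ⊗[R] M m)
      (y : DualNumber R ⊗[R] M n),
      Φ k (D.toOperad.comp h i x y) = D'.toOperad.comp h i (Φ m x) (Φ n y)) ∧
    ∃ d : ∀ n, M n →ₗ[R] M n, ∀ (n : ℕ) (x : M n),
      Φ n (1 ⊗ₜ[R] x) = 1 ⊗ₜ[R] x + DualNumber.eps ⊗ₜ[R] d n x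

/-- An infinitesimal deformation is trivial if it is equivalent to the one defined by the zero
`℘ς`-collection. -/
def InfinitesimalDeformation.IsTrivial {O : OperadStructure R M}
    (D : InfinitesimalDeformation O) : Prop :=
  ∃ D₀ : InfinitesimalDeformation O, D₀.collection = 0 ∧ D.Equivalent D₀

end Cohomology

/-!
A 2-cocycle of `P = As/ᵏI` is a square-zero extension `Q → P`, and a splitting of the extension
exhibits the cocycle as a coboundary. A morphism `As → Q` is the same as a unit together with an
associative unital product in `Q`, so one has to lift the unit and the product of `P` to `Q`.

The unit laws can always be arranged. In `Q`, as in `P`, an operation of arity at least `k` is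
determined by its restrictions. Therefore `As → Q` kills `ᵏI`, and for `k ≤ 3` the associator of
the lifted product, whose restrictions vanish, is zero. For `k ≥ 5` the pentagon identity, which
lives in arity `4 < k`, says that the associator is a Hochschild 3-cocycle of `As`. Every such
cocycle is a multiple of the coboundary of the commutator `x₁ x₂ - x₂ x₁`, by which the product is
corrected. For `k = 4` neither argument applies: the associator lives below the truncation and the
pentagon does not.
-/

universe v₁ v₂

/-! ## Morphisms, truncated operads and products -/

namespace OperadStructure

section Morphisms

variable {R : Type u} [CommRing R] {M : ℕ → Type v} [∀ n, AddCommGroup (M n)]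
  [∀ n, Module R (M n)] {N : ℕ → Type v₁} [∀ n, AddCommGroup (N n)] [∀ n, Module R (N n)]
  {L : ℕ → Type v₂} [∀ n, AddCommGroup (L n)] [∀ n, Module R (L n)]

/-- A morphism of operads. -/
structure Hom (O : OperadStructure R M) (O' : OperadStructure R N) where
  app : ∀ {n : ℕ}, M n →ₗ[R] N n
  map_one : app O.one = O'.one
  map_act : ∀ {n : ℕ} (σ : Equiv.Perm (Fin n)) (x : M n), app (O.act σ x) = O'.act σ (app x)
  map_comp : ∀ {m n k : ℕ} (h : m + n = k + 1) (i : Fin m) (x : M m) (y : M n),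
    app (O.comp h i x y) = O'.comp h i (app x) (app y)

variable {O : OperadStructure R M} {O' : OperadStructure R N} {O'' : OperadStructure R L}

/-- The composite of two operad morphisms, in diagrammatic order. -/
def Hom.trans (φ : Hom O O') (ψ : Hom O' O'') : Hom O O'' where
  app := ψ.app ∘ₗ φ.app
  map_one := by simp only [LinearMap.comp_apply, φ.map_one, ψ.map_one]
  map_act σ x := by simp only [LinearMap.comp_apply, φ.map_act, ψ.map_act]
  map_comp h i x y := by simp only [LinearMap.comp_apply, φ.map_comp, ψ.map_comp]

/-- The projection of an operad onto its quotient by an ideal. -/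
def quotientMk (O : OperadStructure R M) {I : ∀ n, Submodule R (M n)} (hI : O.IsIdeal I) :
    Hom O (O.quotient hI) where
  app {n} := (I n).mkQ
  map_one := rfl
  map_act _ _ := rfl
  map_comp _ _ _ _ := rfl

/-- The morphism out of a quotient operad induced by a morphism that kills the ideal. -/
def Hom.quotientLift (φ : Hom O O') {I : ∀ n, Submodule R (M n)} (hI : O.IsIdeal I)
    (hφ : ∀ {n : ℕ}, ∀ x ∈ I n, φ.app x = 0) : Hom (O.quotient hI) O' where
  app {n} := (I n).liftQ φ.app fun x hx => LinearMap.mem_ker.2 (hφ x hx)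
  map_one := φ.map_one
  map_act σ x := by
    obtain ⟨x, rfl⟩ := Submodule.Quotient.mk_surjective _ x
    exact φ.map_act σ x
  map_comp h i x y := by
    obtain ⟨x, rfl⟩ := Submodule.Quotient.mk_surjective _ x
    obtain ⟨y, rfl⟩ := Submodule.Quotient.mk_surjective _ y
    exact φ.map_comp h i x y

end Morphisms

section Truncated

variable {R : Type u} [CommRing R] {M : ℕ → Type v} [∀ n, AddCommGroup (M n)]
  [∀ n, Module R (M n)] {N : ℕ → Type v₁} [∀ n, AddCommGroup (N n)] [∀ n, Module R (N n)]
  {O : OperadStructure R M} {O' : OperadStructure R N} {u : M 0} {k : ℕ}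

/-- The restriction operator that fills the input `j` with the `0`-unit `u`. -/
def plugUnit (O : OperadStructure R M) (u : M 0) {n : ℕ} (j : Fin (n + 1)) : M (n + 1) →ₗ[R] M n :=
  (O.comp (m := n + 1) (n := 0) (k := n) rfl j).flip u

theorem Hom.map_plugUnit (φ : Hom O O') {n : ℕ} (j : Fin (n + 1)) (x : M (n + 1)) :
    φ.app (O.plugUnit u j x) = O'.plugUnit (φ.app u) j (φ.app x) :=
  φ.map_comp _ _ _ _

/-- An operad is `k`-truncated with respect to `u` if the operations of arity at least `k` are
determined by their restrictions. -/
def IsTruncated (O : OperadStructure R M) (u : M 0) (k : ℕ) : Prop :=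
  ∀ ⦃n : ℕ⦄, k ≤ n + 1 → ∀ x : M (n + 1), (∀ j, O.plugUnit u j x = 0) → x = 0

theorem isTruncated_quotient_truncIdeal (hk : 1 ≤ k) (hI : O.IsIdeal (O.truncIdeal u k)) :
    (O.quotient hI).IsTruncated ((O.quotientMk hI).app u) k := by
  intro n hn x hx
  obtain ⟨x, rfl⟩ := Submodule.Quotient.mk_surjective _ x
  rw [Submodule.Quotient.mk_eq_zero, O.mem_truncIdeal_succ u hk hn]
  exact fun j => (Submodule.Quotient.mk_eq_zero _).1 (hx j)

theorem Hom.map_eq_zero_of_mem_truncIdeal (φ : Hom O O') (hk : 1 ≤ k)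
    (hO' : O'.IsTruncated (φ.app u) k) {n : ℕ} {x : M n} (hx : x ∈ O.truncIdeal u k n) :
    φ.app x = 0 := by
  induction n with
  | zero => rw [(O.mem_truncIdeal_of_lt u hk x).1 hx, map_zero]
  | succ n ih =>
    rcases Nat.lt_or_ge (n + 1) k with hn | hn
    · rw [(O.mem_truncIdeal_of_lt u hn x).1 hx, map_zero]
    · refine hO' hn _ fun j => ?_
      rw [← φ.map_plugUnit]
      exact ih (O.comp_unit_mem_truncIdeal u rfl j x hx)

end Truncated

section Products

variable {R : Type u} [CommRing R] {M : ℕ → Type v} [∀ n, AddCommGroup (M n)]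
  [∀ n, Module R (M n)] {N : ℕ → Type v₁} [∀ n, AddCommGroup (N n)] [∀ n, Module R (N n)]
  {O : OperadStructure R M} {O' : OperadStructure R N} {u : M 0} {μ : M 2}

/-- The associator of a binary operation. -/
def associator (O : OperadStructure R M) (μ : M 2) : M 3 :=
  O.comp (m := 2) (n := 2) (k := 3) rfl 0 μ μ - O.comp (m := 2) (n := 2) (k := 3) rfl 1 μ μ

/-- The binary operation `μ` has the two-sided unit `u`. -/
structure IsUnital (O : OperadStructure R M) (u : M 0) (μ : M 2) : Prop where
  left_unit : O.plugUnit u 0 μ = O.one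
  right_unit : O.plugUnit u 1 μ = O.one

/-- The binary operation `μ` is associative with two-sided unit `u`. -/
structure IsAssocUnital (O : OperadStructure R M) (u : M 0) (μ : M 2) : Prop
    extends O.IsUnital u μ where
  associator_eq_zero : O.associator μ = 0

theorem Hom.map_associator (φ : Hom O O') (μ : M 2) :
    φ.app (O.associator μ) = O'.associator (φ.app μ) := by
  simp only [associator, map_sub, φ.map_comp]

theorem IsAssocUnital.map (H : O.IsAssocUnital u μ) (φ : Hom O O') :
    O'.IsAssocUnital (φ.app u) (φ.app μ) where
  left_unit := by rw [← φ.map_plugUnit, H.left_unit, φ.map_one]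
  right_unit := by rw [← φ.map_plugUnit, H.right_unit, φ.map_one]
  associator_eq_zero := by rw [← φ.map_associator, H.associator_eq_zero, map_zero]

theorem IsUnital.plugUnit_associator (H : O.IsUnital u μ) (j : Fin 3) :
    O.plugUnit u j (O.associator μ) = 0 := by
  have hl : O.comp (m := 2) (n := 0) (k := 1) rfl 0 μ u = O.one := H.left_unit
  have hr : O.comp (m := 2) (n := 0) (k := 1) rfl 1 μ u = O.one := H.right_unit
  rw [associator, map_sub, sub_eq_zero]
  change O.comp (m := 3) (n := 0) (k := 2) rfl j _ u = O.comp (m := 3) (n := 0) (k := 2) rfl j _ u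
  fin_cases j
  · have := O.comp_comm (l := 2) (m := 0) (n := 2) (p := 1) (q := 3) (r := 2) rfl rfl rfl rfl 0 1
      (by decide) 0 rfl 0 rfl μ u μ
    rw [hl, O.one_comp] at this
    refine Eq.trans ?_ this
    rw [O.comp_assoc (m := 2) (p := 3) (q := 1) (r := 2) rfl rfl rfl rfl 0 0 _ rfl, hl, O.comp_one]
  · rw [O.comp_assoc (m := 2) (p := 3) (q := 1) (r := 2) rfl rfl rfl rfl 0 1 _ rfl,
      O.comp_assoc (m := 2) (p := 3) (q := 1) (r := 2) rfl rfl rfl rfl 1 0 _ rfl, hl, hr,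
      O.comp_one, O.comp_one]
  · rw [O.comp_assoc (m := 2) (p := 3) (q := 1) (r := 2) rfl rfl rfl rfl 1 1 _ rfl, hr, O.comp_one,
      O.comp_comm (l := 2) (m := 2) (p := 3) (q := 1) (r := 2) rfl rfl rfl rfl 0 1 (by decide) _ rfl
        0 rfl, hr, O.one_comp]

theorem IsUnital.isAssocUnital_of_isTruncated (H : O.IsUnital u μ) {k : ℕ} (hk : k ≤ 3)
    (hO : O.IsTruncated u k) : O.IsAssocUnital u μ :=
  ⟨H, hO hk _ H.plugUnit_associator⟩

/-- The iterated product of `n` inputs. -/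
def iterProd (O : OperadStructure R M) (u : M 0) (μ : M 2) : ∀ n, M n
  | 0 => u
  | n + 1 => O.comp (m := 2) (n := n) (k := n + 1) (by omega) 0 μ (O.iterProd u μ n)

theorem comp_iterProd {n k : ℕ} (h : 2 + n = k + 1) :
    O.comp h 0 μ (O.iterProd u μ n) = O.iterProd u μ k := by
  obtain rfl : k = n + 1 := by omega
  rfl

theorem Hom.map_iterProd (φ : Hom O O') (u : M 0) (μ : M 2) (n : ℕ) :
    φ.app (O.iterProd u μ n) = O'.iterProd (φ.app u) (φ.app μ) n := by
  induction n with
  | zero => rfl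
  | succ n ih => rw [iterProd, iterProd, φ.map_comp, ih]

namespace IsAssocUnital

theorem comp_comp_iterProd (H : O.IsAssocUnital u μ) {a b p k : ℕ} (hb : 2 + b = p + 1)
    (h : p + a = k + 1) (i : Fin p) (hi : (i : ℕ) = 0) :
    O.comp h i (O.comp hb 1 μ (O.iterProd u μ b)) (O.iterProd u μ a) = O.iterProd u μ k := by
  induction b generalizing p k with
  | zero =>
    obtain rfl : p = 1 := by omega
    obtain rfl : i = 0 := Subsingleton.elim _ _
    obtain rfl : k = a := by omega
    have hμ : O.comp hb 1 μ (O.iterProd u μ 0) = O.one := H.right_unit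
    rw [hμ, O.one_comp]
  | succ b ih =>
    obtain rfl : p = b + 2 := by omega
    obtain rfl : k = a + b + 1 := by omega
    have hassoc : O.comp hb 1 μ (O.iterProd u μ (b + 1)) =
        O.comp (m := 2) (n := b + 1) (k := b + 2) (by omega) 0 μ
          (O.comp (m := 2) (n := b) (k := b + 1) (by omega) 1 μ (O.iterProd u μ b)) := by
      rw [iterProd, ← O.comp_assoc (l := 2) (m := 2) (n := b) (p := 3) (q := b + 1) (r := b + 2)
          rfl (by omega) (by omega) hb 1 0 1 rfl,
        ← O.comp_assoc (l := 2) (m := 2) (n := b) (p := 3) (q := b + 1) (r := b + 2) rfl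
          (by omega) (by omega) hb 0 1 1 rfl, sub_eq_zero.1 H.associator_eq_zero]
    rw [hassoc, O.comp_assoc (l := 2) (m := b + 1) (n := a) (p := b + 2) (q := a + b)
      (r := a + b + 1) hb h (by omega) (by omega) 0 0 i (by simpa using hi),
      ih _ _ _ rfl, comp_iterProd]

theorem iterProd_comp (H : O.IsAssocUnital u μ) {m n k : ℕ} (h : m + n = k + 1) (i : Fin m) :
    O.comp h i (O.iterProd u μ m) (O.iterProd u μ n) = O.iterProd u μ k := by
  induction m generalizing k with
  | zero => exact i.elim0
  | succ m ih =>
    obtain rfl : k = m + n := by omega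
    rw [iterProd]
    rcases Nat.lt_or_ge i m with hi | hi
    · obtain ⟨q, hq⟩ : ∃ q, m + n = q + 1 := ⟨m + n - 1, by omega⟩
      rw [O.comp_assoc (j := ⟨i, hi⟩) _ _ hq (by omega) 0 (a := i) (by simp), ih hq,
        comp_iterProd]
    · rw [O.comp_comm (q := n + 1) _ _ (by omega) (by omega) (0 : Fin 2) (1 : Fin 2) (by decide) i
        (by simp; omega) 0 rfl]
      exact H.comp_comp_iterProd _ _ _ rfl

end IsAssocUnital

end Products

end OperadStructure

/-! ## Morphisms out of `As` -/

section AsProduct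

variable (R : Type u) [CommRing R]

/-- The product `x₁ x₂` of `As`. -/
noncomputable def asMul : Equiv.Perm (Fin 2) →₀ R :=
  Finsupp.single 1 1

theorem permComp_one_one {m n k : ℕ} (h : m + n = k + 1) (i : Fin m) :
    permComp h i 1 1 = 1 := by
  simpa using permComp_mul h i 1 1 1 1

theorem asComp_single_one_one {m n k : ℕ} (h : m + n = k + 1) (i : Fin m) :
    (asOperad R).comp h i (Finsupp.single 1 1) (Finsupp.single 1 1) = Finsupp.single 1 1 :=
  (asComp_single R h i 1 1 1 1).trans (by rw [permComp_one_one, mul_one])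

theorem asOperad_isAssocUnital : (asOperad R).IsAssocUnital (asUnit R) (asMul R) where
  left_unit := asComp_single_one_one R _ _
  right_unit := asComp_single_one_one R _ _
  associator_eq_zero := by
    rw [OperadStructure.associator, asMul, asComp_single_one_one, asComp_single_one_one, sub_self]

theorem asOperad_iterProd (n : ℕ) :
    (asOperad R).iterProd (asUnit R) (asMul R) n = Finsupp.single 1 1 := by
  induction n with
  | zero => rfl
  | succ n ih => rw [OperadStructure.iterProd, ih, asMul, asComp_single_one_one]

theorem single_eq_smul_act_iterProd {n : ℕ} (σ : Equiv.Perm (Fin n)) (c : R) :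
    Finsupp.single σ c = c • (asOperad R).act σ ((asOperad R).iterProd (asUnit R) (asMul R) n) := by
  change _ = c • asAct R σ _
  simp [asOperad_iterProd, asAct_single]

end AsProduct

namespace OperadStructure

variable {R : Type u} [CommRing R] {M : ℕ → Type v} [∀ n, AddCommGroup (M n)]
  [∀ n, Module R (M n)] {O : OperadStructure R M} {u : M 0} {μ : M 2}

theorem Hom.ext_as {φ ψ : Hom (asOperad R) O} (hu : φ.app (asUnit R) = ψ.app (asUnit R))
    (hμ : φ.app (asMul R) = ψ.app (asMul R)) {n : ℕ} (x : Equiv.Perm (Fin n) →₀ R) :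
    φ.app x = ψ.app x := by
  induction x using Finsupp.induction_linear with
  | zero => rw [map_zero, map_zero]
  | add x y hx hy => rw [map_add, map_add, hx, hy]
  | single σ c =>
    rw [single_eq_smul_act_iterProd, map_smul, map_smul, φ.map_act, ψ.map_act, φ.map_iterProd,
      ψ.map_iterProd, hu, hμ]

/-- The linear maps `As(n) → O(n)`, `σ ↦ μ_n * σ`, where `μ_n` is the `n`-fold product. -/
noncomputable def asLift (O : OperadStructure R M) (u : M 0) (μ : M 2) (n : ℕ) :
    (Equiv.Perm (Fin n) →₀ R) →ₗ[R] M n :=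
  Finsupp.linearCombination R (fun σ => O.act σ (O.iterProd u μ n))

theorem asLift_single {n : ℕ} (σ : Equiv.Perm (Fin n)) (c : R) :
    O.asLift u μ n (Finsupp.single σ c) = c • O.act σ (O.iterProd u μ n) := by
  simp [asLift]

theorem asLift_act {n : ℕ} (σ : Equiv.Perm (Fin n)) (x : Equiv.Perm (Fin n) →₀ R) :
    O.asLift u μ n (asAct R σ x) = O.act σ (O.asLift u μ n x) := by
  induction x using Finsupp.induction_linear with
  | zero => simp only [map_zero]
  | add x y hx hy => simp only [map_add, hx, hy]
  | single τ c => rw [asAct_single, asLift_single, asLift_single, O.act_mul, map_smul]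

theorem comp_act_act {m n k : ℕ} (h : m + n = k + 1) (i : Fin m) (σ : Equiv.Perm (Fin m))
    (τ : Equiv.Perm (Fin n)) (x : M m) (y : M n) :
    O.comp h i (O.act σ x) (O.act τ y) =
      O.act (permComp h i σ τ) (O.comp h (σ i) x y) := by
  have hστ : permComp h i σ τ = permComp h i σ 1 * permComp h i 1 τ := by
    simpa using permComp_mul h i σ 1 1 τ
  rw [O.comp_act_right, O.comp_act_left, hστ, O.act_mul]

namespace IsAssocUnital

theorem asLift_comp (H : O.IsAssocUnital u μ) {m n k : ℕ} (h : m + n = k + 1) (i : Fin m)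
    (x : Equiv.Perm (Fin m) →₀ R) (y : Equiv.Perm (Fin n) →₀ R) :
    O.asLift u μ k (asComp R h i x y) = O.comp h i (O.asLift u μ m x) (O.asLift u μ n y) := by
  induction x using Finsupp.induction_linear with
  | zero => simp only [map_zero, LinearMap.zero_apply]
  | add x x' hx hx' => simp only [map_add, LinearMap.add_apply, hx, hx']
  | single σ c =>
    induction y using Finsupp.induction_linear with
    | zero => simp only [map_zero]
    | add y y' hy hy' => simp only [map_add, hy, hy']
    | single τ d =>
      simp only [asComp_single, asLift_single, map_smul, LinearMap.smul_apply, smul_smul,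
        comp_act_act, H.iterProd_comp]
      rw [mul_comm]

/-- The morphism from `As` that classifies an associative unital product. -/
noncomputable def fromAs (H : O.IsAssocUnital u μ) : Hom (asOperad R) O where
  app {n} := O.asLift u μ n
  map_one := by
    refine (asLift_single 1 1).trans ?_
    rw [one_smul, O.act_one]
    exact H.left_unit
  map_act := asLift_act
  map_comp := H.asLift_comp

theorem fromAs_asUnit (H : O.IsAssocUnital u μ) : H.fromAs.app (asUnit R) = u := by
  refine (asLift_single 1 1).trans ?_
  rw [one_smul, O.act_one, iterProd]

theorem fromAs_asMul (H : O.IsAssocUnital u μ) : H.fromAs.app (asMul R) = μ := by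
  refine (asLift_single 1 1).trans ?_
  rw [one_smul, O.act_one, iterProd]
  exact (congrArg _ H.left_unit).trans (O.comp_one _ _ _)

end IsAssocUnital

end OperadStructure

/-! ## Hochschild cohomology of `As` in degree three -/

namespace OperadStructure

section Hochschild

variable {R : Type u} [CommRing R] {M : ℕ → Type v} [∀ n, AddCommGroup (M n)]
  [∀ n, Module R (M n)] {N : ℕ → Type v₁} [∀ n, AddCommGroup (N n)] [∀ n, Module R (N n)]

/-- The Hochschild differential of binary operations with respect to the product `μ`. -/
def hochschildTwo (O : OperadStructure R M) (μ : M 2) : M 2 →ₗ[R] M 3 :=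
  O.comp (m := 2) (n := 2) (k := 3) rfl 1 μ - (O.comp (m := 2) (n := 2) (k := 3) rfl 0).flip μ
    + (O.comp (m := 2) (n := 2) (k := 3) rfl 1).flip μ
    - O.comp (m := 2) (n := 2) (k := 3) rfl 0 μ

/-- The Hochschild differential of ternary operations with respect to the product `μ`. -/
def hochschildThree (O : OperadStructure R M) (μ : M 2) : M 3 →ₗ[R] M 4 :=
  O.comp (m := 2) (n := 3) (k := 4) rfl 1 μ - (O.comp (m := 3) (n := 2) (k := 4) rfl 0).flip μ
    + (O.comp (m := 3) (n := 2) (k := 4) rfl 1).flip μ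
    - (O.comp (m := 3) (n := 2) (k := 4) rfl 2).flip μ
    + O.comp (m := 2) (n := 3) (k := 4) rfl 0 μ

theorem hochschildTwo_apply (O : OperadStructure R M) (μ b : M 2) :
    O.hochschildTwo μ b = O.comp (m := 2) (n := 2) (k := 3) rfl 1 μ b
      - O.comp (m := 2) (n := 2) (k := 3) rfl 0 b μ + O.comp (m := 2) (n := 2) (k := 3) rfl 1 b μ
      - O.comp (m := 2) (n := 2) (k := 3) rfl 0 μ b := rfl

theorem hochschildThree_apply (O : OperadStructure R M) (μ : M 2) (f : M 3) :
    O.hochschildThree μ f = O.comp (m := 2) (n := 3) (k := 4) rfl 1 μ f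
      - O.comp (m := 3) (n := 2) (k := 4) rfl 0 f μ + O.comp (m := 3) (n := 2) (k := 4) rfl 1 f μ
      - O.comp (m := 3) (n := 2) (k := 4) rfl 2 f μ
      + O.comp (m := 2) (n := 3) (k := 4) rfl 0 μ f := rfl

theorem hochschildThree_associator (O : OperadStructure R M) (μ : M 2) :
    O.hochschildThree μ (O.associator μ) = 0 := by
  simp only [hochschildThree_apply, associator, map_sub]
  rw [O.comp_assoc (l := 2) (m := 2) (p := 3) (q := 3) (r := 4) rfl rfl rfl rfl 0 0 0 rfl,
    O.comp_assoc (l := 2) (m := 2) (p := 3) (q := 3) (r := 4) rfl rfl rfl rfl 0 1 1 rfl,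
    O.comp_assoc (l := 2) (m := 2) (p := 3) (q := 3) (r := 4) rfl rfl rfl rfl 1 0 1 rfl,
    O.comp_assoc (l := 2) (m := 2) (p := 3) (q := 3) (r := 4) rfl rfl rfl rfl 1 1 2 rfl,
    O.comp_comm (l := 2) (m := 2) (p := 3) (q := 3) (r := 4) rfl rfl rfl rfl 0 1 (by decide) 2 rfl
      0 rfl]
  abel

variable {O : OperadStructure R M} {O' : OperadStructure R N}

theorem Hom.map_hochschildTwo (φ : Hom O O') (μ b : M 2) :
    φ.app (O.hochschildTwo μ b) = O'.hochschildTwo (φ.app μ) (φ.app b) := by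
  simp only [hochschildTwo_apply, map_add, map_sub, φ.map_comp]

theorem Hom.map_hochschildThree (φ : Hom O O') (μ : M 2) (f : M 3) :
    φ.app (O.hochschildThree μ f) = O'.hochschildThree (φ.app μ) (φ.app f) := by
  simp only [hochschildThree_apply, map_add, map_sub, φ.map_comp]

end Hochschild

end OperadStructure

section PermComp

variable {m n k : ℕ} (h : m + n = k + 1) (i : Fin m)

theorem permComp_eq_iff (σ : Equiv.Perm (Fin m)) (τ : Equiv.Perm (Fin n)) (ρ : Equiv.Perm (Fin k)) :
    permComp h i σ τ = ρ ↔
      (∀ b : {b : Fin m // b ≠ i}, ρ (slotFun h i (Sum.inl b)) =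
        slotFun h (σ i) (Sum.inl ⟨σ b.1, fun e => b.2 (σ.injective e)⟩)) ∧
      ∀ t : Fin n, ρ (slotFun h i (Sum.inr t)) = slotFun h (σ i) (Sum.inr (τ t)) := by
  rw [Equiv.ext_iff, (slotFun_bijective h i).surjective.forall, Sum.forall]
  simp only [permComp_inl, permComp_inr, eq_comm]

variable (R : Type u) [CommRing R]

theorem asComp_single_right_apply (x : Equiv.Perm (Fin m) →₀ R) (τ : Equiv.Perm (Fin n))
    (ρ : Equiv.Perm (Fin k)) :
    asComp R h i x (Finsupp.single τ 1) ρ = ∑ σ with permComp h i σ τ = ρ, x σ := by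
  induction x using Finsupp.induction_linear with
  | zero => simp
  | add x y hx hy =>
    simp only [map_add, LinearMap.add_apply, Finsupp.add_apply, hx, hy, Finset.sum_add_distrib]
  | single σ c =>
    simp [asComp_single, Finsupp.single_apply]

theorem asComp_single_left_apply (σ : Equiv.Perm (Fin m)) (y : Equiv.Perm (Fin n) →₀ R)
    (ρ : Equiv.Perm (Fin k)) :
    asComp R h i (Finsupp.single σ 1) y ρ = ∑ τ with permComp h i σ τ = ρ, y τ := by
  induction y using Finsupp.induction_linear with
  | zero => simp
  | add x y hx hy => simp only [map_add, Finsupp.add_apply, hx, hy, Finset.sum_add_distrib]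
  | single τ c =>
    simp [asComp_single, Finsupp.single_apply]

end PermComp

section AsHochschild

variable (R : Type u) [CommRing R]

/-- The commutator `x₁ x₂ - x₂ x₁` of `As`. -/
noncomputable def asCommutator : Equiv.Perm (Fin 2) →₀ R :=
  Finsupp.single 1 1 - Finsupp.single (Equiv.swap 0 1) 1

theorem plugUnit_asCommutator (j : Fin 2) :
    (asOperad R).plugUnit (asUnit R) j (asCommutator R) = 0 := by
  have hperm : permComp (m := 2) (n := 0) (k := 1) rfl j 1 1 =
      permComp (m := 2) (n := 0) (k := 1) rfl j (Equiv.swap 0 1) 1 := Subsingleton.elim _ _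
  change asComp R (m := 2) (n := 0) (k := 1) rfl j _ _ = 0
  simp only [asCommutator, asUnit, map_sub, LinearMap.sub_apply, asComp_single, hperm, sub_self]

theorem hochschildTwo_asCommutator :
    (asOperad R).hochschildTwo (asMul R) (asCommutator R) =
      Finsupp.single (Equiv.swap 0 1) 1 - Finsupp.single (Equiv.swap 1 2) 1
        + Finsupp.single (finRotate 3) 1 - Finsupp.single (finRotate 3)⁻¹ 1 := by
  have hperm : permComp (m := 2) (n := 2) (k := 3) rfl 1 1 (Equiv.swap 0 1) = Equiv.swap 1 2 ∧
      permComp (m := 2) (n := 2) (k := 3) rfl 0 (Equiv.swap 0 1) 1 = finRotate 3 ∧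
      permComp (m := 2) (n := 2) (k := 3) rfl 1 (Equiv.swap 0 1) 1 = (finRotate 3)⁻¹ ∧
      permComp (m := 2) (n := 2) (k := 3) rfl 0 1 (Equiv.swap 0 1) = Equiv.swap 0 1 := by
    simp only [permComp_eq_iff]
    decide
  rw [OperadStructure.hochschildTwo_apply]
  change asComp R _ 1 _ _ - asComp R _ 0 _ _ + asComp R _ 1 _ _ - asComp R _ 0 _ _ = _
  simp only [asMul, asCommutator, map_sub, LinearMap.sub_apply, asComp_single, permComp_one_one,
    hperm, mul_one]
  abel

variable {R} {f : Equiv.Perm (Fin 3) →₀ R}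

theorem hochschildThree_asMul_apply (ρ : Equiv.Perm (Fin 4))
    (s₁ s₂ s₃ s₄ s₅ : Finset (Equiv.Perm (Fin 3)))
    (hs : ∀ σ, (permComp (m := 2) (n := 3) (k := 4) rfl 1 1 σ = ρ ↔ σ ∈ s₁) ∧
      (permComp (m := 3) (n := 2) (k := 4) rfl 0 σ 1 = ρ ↔ σ ∈ s₂) ∧
      (permComp (m := 3) (n := 2) (k := 4) rfl 1 σ 1 = ρ ↔ σ ∈ s₃) ∧
      (permComp (m := 3) (n := 2) (k := 4) rfl 2 σ 1 = ρ ↔ σ ∈ s₄) ∧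
      (permComp (m := 2) (n := 3) (k := 4) rfl 0 1 σ = ρ ↔ σ ∈ s₅)) :
    (asOperad R).hochschildThree (asMul R) f ρ =
      ∑ σ ∈ s₁, f σ - ∑ σ ∈ s₂, f σ + ∑ σ ∈ s₃, f σ - ∑ σ ∈ s₄, f σ + ∑ σ ∈ s₅, f σ := by
  rw [OperadStructure.hochschildThree_apply]
  change (asComp R _ 1 _ _ - asComp R _ 0 _ _ + asComp R _ 1 _ _ - asComp R _ 2 _ _
    + asComp R _ 0 _ _ : _ →₀ R) ρ = _
  simp only [asMul, Finsupp.add_apply, Finsupp.sub_apply, asComp_single_left_apply,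
    asComp_single_right_apply, hs, Finset.filter_univ_mem]

theorem coeff_relations_of_hochschildThree_eq_zero
    (hf : (asOperad R).hochschildThree (asMul R) f = 0) :
    f 1 = 0 ∧ f (Equiv.swap 0 2) = 0 ∧ f (Equiv.swap 0 1) = -f (Equiv.swap 1 2) ∧
      f (finRotate 3) = -f (Equiv.swap 1 2) ∧ f (finRotate 3)⁻¹ = f (Equiv.swap 1 2) := by
  -- The coefficients of five monomials `x₁ x_{σ 2} x_{σ 3} x_{σ 4}`.
  have h1 := hochschildThree_asMul_apply (f := f) 1 {1} {1} {1} {1} {1}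
    (by simp only [permComp_eq_iff, forall_and]; refine ⟨?_, ?_, ?_, ?_, ?_⟩ <;> decide)
  have h13 := hochschildThree_asMul_apply (f := f) (Equiv.swap 1 3) {Equiv.swap 0 2} ∅ ∅ ∅ ∅
    (by simp only [permComp_eq_iff]; decide)
  have h12 := hochschildThree_asMul_apply (f := f) (Equiv.swap 1 2) {Equiv.swap 0 1} ∅ ∅ ∅
    {Equiv.swap 1 2} (by simp only [permComp_eq_iff]; decide)
  have hrot := hochschildThree_asMul_apply (f := f) (Equiv.swap 1 2 * Equiv.swap 2 3)
    {finRotate 3} ∅ {Equiv.swap 1 2} ∅ ∅ (by simp only [permComp_eq_iff]; decide)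
  have hrot' := hochschildThree_asMul_apply (f := f) (Equiv.swap 2 3 * Equiv.swap 1 2)
    {(finRotate 3)⁻¹} ∅ ∅ {Equiv.swap 1 2} ∅ (by simp only [permComp_eq_iff]; decide)
  simp only [hf, Finsupp.coe_zero, Pi.zero_apply, Finset.sum_singleton, Finset.sum_empty]
    at h1 h13 h12 hrot hrot'
  refine ⟨?_, ?_, ?_, ?_, ?_⟩
  · linear_combination -h1
  · linear_combination -h13
  · linear_combination -h12
  · linear_combination -hrot
  · linear_combination -hrot'

theorem eq_hochschildTwo_of_hochschildThree_eq_zero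
    (hf : (asOperad R).hochschildThree (asMul R) f = 0) :
    (asOperad R).hochschildTwo (asMul R) (-f (Equiv.swap 1 2) • asCommutator R) = f := by
  obtain ⟨h1, h02, h01, hrot, hrot'⟩ := coeff_relations_of_hochschildThree_eq_zero hf
  have hcases : ∀ σ : Equiv.Perm (Fin 3), σ = 1 ∨ σ = Equiv.swap 0 2 ∨ σ = Equiv.swap 0 1 ∨
      σ = Equiv.swap 1 2 ∨ σ = finRotate 3 ∨ σ = (finRotate 3)⁻¹ := by decide
  rw [map_smul, hochschildTwo_asCommutator]
  ext σ
  simp only [Finsupp.smul_apply, Finsupp.add_apply, Finsupp.sub_apply, Finsupp.single_apply,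
    smul_eq_mul]
  rcases hcases σ with rfl | rfl | rfl | rfl | rfl | rfl <;>
    simp +decide [h1, h02, h01, hrot, hrot']

theorem exists_normalized_hochschildTwo_eq
    (hf : (asOperad R).hochschildThree (asMul R) f = 0) :
    ∃ b, (∀ j : Fin 2, (asOperad R).plugUnit (asUnit R) j b = 0) ∧
      (asOperad R).hochschildTwo (asMul R) b = f :=
  ⟨_, fun j => by rw [map_smul, plugUnit_asCommutator, smul_zero],
    eq_hochschildTwo_of_hochschildThree_eq_zero hf⟩

end AsHochschild

/-! ## Square-zero extensions -/

namespace OperadStructure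

section SquareZero

variable {R : Type u} [CommRing R] {M : ℕ → Type v} [∀ n, AddCommGroup (M n)]
  [∀ n, Module R (M n)] {O : OperadStructure R M} {w : WVCollection R M}

/-- The action `(x + x' ε) * σ = x * σ + (x' * σ + ς(x, σ)) ε` deformed by `(℘, ς)`. -/
def squareZeroAct (O : OperadStructure R M) (w : WVCollection R M) {n : ℕ}
    (σ : Equiv.Perm (Fin n)) : M n × M n →ₗ[R] M n × M n :=
  (O.act σ ∘ₗ LinearMap.fst R _ _).prod
    (O.act σ ∘ₗ LinearMap.snd R _ _ + w.vs σ ∘ₗ LinearMap.fst R _ _)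

/-- The partial composition
`(x + x' ε) ∘_i (y + y' ε) = x ∘_i y + (x' ∘_i y + x ∘_i y' + ℘_i(x, y)) ε` deformed by `(℘, ς)`. -/
def squareZeroComp (O : OperadStructure R M) (w : WVCollection R M) {m n k : ℕ}
    (h : m + n = k + 1) (i : Fin m) : M m × M m →ₗ[R] M n × M n →ₗ[R] M k × M k :=
  LinearMap.mk₂ R
    (fun x y => (O.comp h i x.1 y.1, O.comp h i x.2 y.1 + O.comp h i x.1 y.2 + w.wp h i x.1 y.1))
    (fun x x' y => Prod.ext (by simp) <| by
      simp only [Prod.fst_add, Prod.snd_add, map_add, LinearMap.add_apply]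
      abel)
    (fun c x y => by ext <;> simp)
    (fun x y y' => Prod.ext (by simp) <| by
      simp only [Prod.fst_add, Prod.snd_add, map_add]
      abel)
    (fun c x y => by ext <;> simp)

theorem squareZeroAct_apply {n : ℕ} (σ : Equiv.Perm (Fin n)) (x : M n × M n) :
    O.squareZeroAct w σ x = (O.act σ x.1, O.act σ x.2 + w.vs σ x.1) := rfl

theorem squareZeroComp_apply {m n k : ℕ} (h : m + n = k + 1) (i : Fin m) (x : M m × M m)
    (y : M n × M n) :
    O.squareZeroComp w h i x y = (O.comp h i x.1 y.1,
      O.comp h i x.2 y.1 + O.comp h i x.1 y.2 + w.wp h i x.1 y.1) := rfl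

/-- The square-zero extension of an operad by a 2-cocycle `(℘, ς)`: the pair `(x, x')` stands for
`x + x' ε`. The identity needs a correction because `℘_1(1, 1)` may not vanish. -/
def squareZero (O : OperadStructure R M) {w : WVCollection R M}
    (hw : O.IsTwoCocycle w) : OperadStructure R (fun n => M n × M n) where
  one := (O.one, -w.wp (m := 1) (n := 1) (k := 1) rfl 0 O.one O.one)
  act := O.squareZeroAct w
  comp := O.squareZeroComp w
  act_one x := by
    have e := hw.act_mul x.1 1 1
    rw [O.act_one, O.act_one, mul_one, left_eq_add] at e
    simp only [squareZeroAct_apply, O.act_one, e, add_zero]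
  act_mul σ τ x := by
    refine Prod.ext (O.act_mul σ τ _) ?_
    simp only [squareZeroAct_apply, O.act_mul, hw.act_mul, map_add]
    abel
  comp_one {m} h i x := by
    have e := hw.assoc (l := m) (m := 1) (n := 1) rfl rfl rfl rfl i 0 i (by simp) x.1 O.one O.one
    rw [O.comp_one, O.comp_one, O.comp_one, add_right_inj] at e
    simp only [squareZeroComp_apply, O.comp_one, map_neg, e, neg_add_cancel_right]
  one_comp {n} h x := by
    have e := hw.assoc (l := 1) (m := 1) (n := n) rfl h h h 0 0 0 rfl O.one O.one x.1
    rw [O.one_comp, O.one_comp, O.one_comp, add_right_inj] at e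
    simp only [squareZeroComp_apply, O.one_comp, map_neg, LinearMap.neg_apply, e]
    abel_nf
  comp_assoc hp hr hq hr' i j a ha x y z := by
    have e := hw.assoc hp hr hq hr' i j a ha x.1 y.1 z.1
    refine Prod.ext (O.comp_assoc hp hr hq hr' i j a ha _ _ _) ?_
    simp only [squareZeroComp_apply, map_add, LinearMap.add_apply,
      O.comp_assoc hp hr hq hr' i j a ha] at e ⊢
    linear_combination (norm := abel) e
  comp_comm hp hr hq hr' i k hik a ha b hb x y z := by
    have e := hw.comm hp hr hq hr' i k hik a ha b hb x.1 y.1 z.1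
    refine Prod.ext (O.comp_comm hp hr hq hr' i k hik a ha b hb _ _ _) ?_
    simp only [squareZeroComp_apply, map_add, LinearMap.add_apply,
      O.comp_comm hp hr hq hr' i k hik a ha b hb] at e ⊢
    linear_combination (norm := abel) e
  comp_act_right h i x y σ := by
    have e := hw.act_right h i x.1 y.1 σ
    refine Prod.ext (O.comp_act_right h i _ _ σ) ?_
    simp only [squareZeroComp_apply, squareZeroAct_apply, map_add, O.comp_act_right] at e ⊢
    linear_combination (norm := abel) e
  comp_act_left h i x y φ := by
    have e := hw.act_left h i x.1 y.1 φ
    refine Prod.ext (O.comp_act_left h i _ _ φ) ?_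
    simp only [squareZeroComp_apply, squareZeroAct_apply, map_add, LinearMap.add_apply,
      O.comp_act_left] at e ⊢
    linear_combination (norm := abel) e

/-- The projection of a square-zero extension onto the operad it extends. -/
def squareZeroFst (hw : O.IsTwoCocycle w) : Hom (O.squareZero hw) O where
  app := LinearMap.fst R _ _
  map_one := rfl
  map_act _ _ := rfl
  map_comp _ _ _ _ := rfl

theorem mem_B2Star_of_hom_section (hw : O.IsTwoCocycle w) (s : Hom O (O.squareZero hw))
    (hs : ∀ {n : ℕ} (x : M n), (s.app x).1 = x) : w ∈ O.B2Star := by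
  refine ⟨fun _ => LinearMap.snd R _ _ ∘ₗ s.app, WVCollection.ext (fun h i x y => ?_)
    fun σ x => ?_⟩
  · have e : (s.app (O.comp h i x y)).2 = (O.squareZeroComp w h i (s.app x) (s.app y)).2 :=
      congrArg Prod.snd (s.map_comp h i x y)
    simp only [O.coboundary_wp, LinearMap.comp_apply, LinearMap.snd_apply, e,
      squareZeroComp_apply, hs, add_sub_cancel_left]
  · have e : (s.app (O.act σ x)).2 = (O.squareZeroAct w σ (s.app x)).2 :=
      congrArg Prod.snd (s.map_act σ x)
    simp only [O.coboundary_vs, LinearMap.comp_apply, LinearMap.snd_apply, e,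
      squareZeroAct_apply, hs, add_sub_cancel_left]

theorem squareZero_comp_eps_left (hw : O.IsTwoCocycle w) {m n k : ℕ} (h : m + n = k + 1)
    (i : Fin m) (x : M m) (y : M n × M n) :
    (O.squareZero hw).comp h i (0, x) y = (0, O.comp h i x y.1) :=
  (squareZeroComp_apply h i _ _).trans (by simp)

theorem squareZero_comp_eps_right (hw : O.IsTwoCocycle w) {m n k : ℕ} (h : m + n = k + 1)
    (i : Fin m) (x : M m × M m) (y : M n) :
    (O.squareZero hw).comp h i x (0, y) = (0, O.comp h i x.1 y) :=
  (squareZeroComp_apply h i _ _).trans (by simp)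

theorem IsTruncated.squareZero {u : M 0} {k : ℕ} (hO : O.IsTruncated u k)
    (hw : O.IsTwoCocycle w) (u' : M 0) : (O.squareZero hw).IsTruncated (u, u') k := by
  rintro n hn ⟨x, x'⟩ hx
  obtain rfl : x = 0 := hO hn x fun j => congrArg Prod.fst (hx j)
  refine Prod.ext rfl (hO hn x' fun j => ?_)
  exact congrArg Prod.snd ((squareZero_comp_eps_left hw _ j x' (u, u')).symm.trans (hx j))

end SquareZero

section Lifting

variable {R : Type u} [CommRing R] {M : ℕ → Type v} [∀ n, AddCommGroup (M n)]
  [∀ n, Module R (M n)] {O : OperadStructure R M} {w : WVCollection R M} {u : M 0} {μ : M 2}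

theorem squareZero_plugUnit_add_eps (hw : O.IsTwoCocycle w) {n : ℕ} (j : Fin (n + 1))
    (x : M (n + 1) × M (n + 1)) (z : M (n + 1)) :
    (O.squareZero hw).plugUnit (u, 0) j (x + (0, z)) =
      (O.squareZero hw).plugUnit (u, 0) j x + (0, O.plugUnit u j z) := by
  rw [map_add]
  exact congrArg _ (squareZero_comp_eps_left hw _ j z (u, 0))

theorem squareZero_associator_add_eps (hw : O.IsTwoCocycle w) (x : M 2 × M 2) (b : M 2) :
    (O.squareZero hw).associator (x + (0, b)) =
      (O.squareZero hw).associator x - (0, O.hochschildTwo x.1 b) := by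
  simp only [associator, map_add, LinearMap.add_apply, squareZero_comp_eps_left,
    squareZero_comp_eps_right, hochschildTwo_apply]
  ext
  · simp
  · simp only [Prod.snd_add, Prod.snd_sub, map_zero]
    abel

theorem squareZero_hochschildThree_eps (hw : O.IsTwoCocycle w) (x : M 2 × M 2) (g : M 3) :
    (O.squareZero hw).hochschildThree x (0, g) = (0, O.hochschildThree x.1 g) := by
  simp only [hochschildThree_apply, squareZero_comp_eps_left, squareZero_comp_eps_right]
  simp

theorem exists_eq_squareZero_one_add_eps (hw : O.IsTwoCocycle w) {x : M 1 × M 1}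
    (hx : x.1 = O.one) : ∃ e, x = (O.squareZero hw).one + (0, e) :=
  ⟨x.2 - (O.squareZero hw).one.2, Prod.ext (hx.trans (add_zero _).symm)
    (add_sub_cancel _ _).symm⟩

namespace IsUnital

-- The left-unit defect `e` of the lift `(μ, 0)` is removed by subtracting `e ∘ μ`. The right unit
-- law is then forced, as both orders of plugging two units into the product agree.
theorem exists_lift (H : O.IsUnital u μ) (hw : O.IsTwoCocycle w)
    (hu : ∀ z : M 1, O.plugUnit u 0 z = 0 → z = 0) :
    ∃ m, (O.squareZero hw).IsUnital (u, 0) (μ, m) := by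
  obtain ⟨e, he⟩ := exists_eq_squareZero_one_add_eps hw
    (x := (O.squareZero hw).plugUnit (u, 0) 0 (μ, 0)) H.left_unit
  set b := O.comp (m := 1) (n := 2) (k := 2) rfl 0 e μ
  obtain ⟨d, hd⟩ := exists_eq_squareZero_one_add_eps hw
    (x := (O.squareZero hw).plugUnit (u, 0) 1 (μ, -b)) H.right_unit
  have hb : O.plugUnit u 0 b = e := by
    refine (O.comp_assoc (l := 1) (m := 2) (n := 0) (p := 2) (q := 1) (r := 1) rfl rfl rfl rfl
      0 0 0 rfl e μ u).trans ?_
    exact (congrArg _ H.left_unit).trans (O.comp_one _ _ _)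
  have hl : (O.squareZero hw).plugUnit (u, 0) 0 (μ, -b) = (O.squareZero hw).one := by
    have hsplit : ((μ, -b) : M 2 × M 2) = (μ, 0) + (0, -b) := by simp
    have hcancel : ((0, e) + (0, -e) : M 1 × M 1) = 0 := by simp
    rw [hsplit, squareZero_plugUnit_add_eps, he, map_neg, hb, add_assoc, hcancel, add_zero]
  have hcomm : (O.squareZero hw).plugUnit (u, 0) 0 ((O.squareZero hw).plugUnit (u, 0) 0 (μ, -b)) =
      (O.squareZero hw).plugUnit (u, 0) 0 ((O.squareZero hw).plugUnit (u, 0) 1 (μ, -b)) :=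
    (O.squareZero hw).comp_comm (l := 2) (m := 0) (n := 0) (p := 1) (q := 1) (r := 0)
      rfl rfl rfl rfl 0 1 (by decide) 0 rfl 0 rfl _ _ _
  rw [hl, hd, squareZero_plugUnit_add_eps, left_eq_add] at hcomm
  refine ⟨-b, hl, ?_⟩
  rw [hd, hu d (congrArg Prod.snd hcomm), Prod.mk_zero_zero, add_zero]

end IsUnital

namespace IsAssocUnital

theorem exists_lift_of_isTruncated (H : O.IsAssocUnital u μ) (hw : O.IsTwoCocycle w)
    (hu : ∀ z : M 1, O.plugUnit u 0 z = 0 → z = 0) {k : ℕ} (hk : k ≤ 3)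
    (hO : O.IsTruncated u k) :
    ∃ m, (O.squareZero hw).IsAssocUnital (u, 0) (μ, m) :=
  (H.exists_lift hw hu).imp fun _ hm => hm.isAssocUnital_of_isTruncated hk (hO.squareZero hw 0)

theorem exists_lift_of_exact (H : O.IsAssocUnital u μ) (hw : O.IsTwoCocycle w)
    (hu : ∀ z : M 1, O.plugUnit u 0 z = 0 → z = 0)
    (hexact : ∀ g, O.hochschildThree μ g = 0 →
      ∃ b, (∀ j : Fin 2, O.plugUnit u j b = 0) ∧ O.hochschildTwo μ b = g) :
    ∃ m, (O.squareZero hw).IsAssocUnital (u, 0) (μ, m) := by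
  obtain ⟨m, hm⟩ := H.exists_lift hw hu
  obtain ⟨g, hg⟩ : ∃ g, (O.squareZero hw).associator (μ, m) = (0, g) :=
    ⟨_, Prod.ext H.associator_eq_zero rfl⟩
  have hcocycle : O.hochschildThree μ g = 0 := by
    have h := (O.squareZero hw).hochschildThree_associator (μ, m)
    rw [hg, squareZero_hochschildThree_eps] at h
    exact congrArg Prod.snd h
  obtain ⟨b, hbu, hb⟩ := hexact g hcocycle
  have hplug (j : Fin 2) : (O.squareZero hw).plugUnit (u, 0) j ((μ, m) + (0, b)) =
      (O.squareZero hw).plugUnit (u, 0) j (μ, m) := by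
    rw [squareZero_plugUnit_add_eps, hbu j, Prod.mk_zero_zero, add_zero]
  have hsum : ((μ, m) + (0, b) : M 2 × M 2) = (μ, m + b) := by simp
  rw [hsum] at hplug
  refine ⟨m + b, ⟨(hplug 0).trans hm.left_unit, (hplug 1).trans hm.right_unit⟩, ?_⟩
  rw [← hsum, squareZero_associator_add_eps, hg, hb, sub_self]

end IsAssocUnital

end Lifting

end OperadStructure

/-! ## The truncations of `As` -/

section AsTrunc

variable (R : Type u) [CommRing R] (k : ℕ)

/-- The projection `As → As/ᵏI`. -/
noncomputable def asTruncMk : OperadStructure.Hom (asOperad R) (asTrunc R k) :=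
  (asOperad R).quotientMk _

variable {R k}

theorem asTruncMk_surjective {n : ℕ} :
    Function.Surjective ((asTruncMk R k).app : (Equiv.Perm (Fin n) →₀ R) →ₗ[R] _) :=
  Submodule.mkQ_surjective _

theorem asTruncMk_injective {n : ℕ} (hn : n < k) :
    Function.Injective ((asTruncMk R k).app : (Equiv.Perm (Fin n) →₀ R) →ₗ[R] _) :=
  (injective_iff_map_eq_zero _).2 fun x hx =>
    ((asOperad R).mem_truncIdeal_of_lt _ hn x).1 ((Submodule.Quotient.mk_eq_zero _).1 hx)

theorem asTrunc_isTruncated (hk : 1 ≤ k) :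
    (asTrunc R k).IsTruncated ((asTruncMk R k).app (asUnit R)) k :=
  OperadStructure.isTruncated_quotient_truncIdeal hk _

theorem asTrunc_isAssocUnital :
    (asTrunc R k).IsAssocUnital ((asTruncMk R k).app (asUnit R)) ((asTruncMk R k).app (asMul R)) :=
  (asOperad_isAssocUnital R).map (asTruncMk R k)

theorem asTrunc_eq_zero_of_plugUnit_eq_zero (hk : 1 ≤ k) (z : AsTruncModule R k 1)
    (hz : (asTrunc R k).plugUnit ((asTruncMk R k).app (asUnit R)) 0 z = 0) : z = 0 := by
  obtain ⟨x, rfl⟩ := asTruncMk_surjective z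
  obtain ⟨c, rfl⟩ : ∃ c, x = Finsupp.single 1 c := ⟨x 1, Finsupp.unique_single x⟩
  rw [← OperadStructure.Hom.map_plugUnit, map_eq_zero_iff _ (asTruncMk_injective (by omega))] at hz
  have hc : asComp R (m := 1) (n := 0) (k := 0) rfl 0 (Finsupp.single 1 c)
    (Finsupp.single 1 1) = 0 := hz
  rw [asComp_single, mul_one, Finsupp.single_eq_zero] at hc
  rw [hc, Finsupp.single_zero, map_zero]

theorem asTrunc_exists_normalized_hochschildTwo_eq (hk : 4 < k) {g : AsTruncModule R k 3}
    (hg : (asTrunc R k).hochschildThree ((asTruncMk R k).app (asMul R)) g = 0) :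
    ∃ b, (∀ j : Fin 2, (asTrunc R k).plugUnit ((asTruncMk R k).app (asUnit R)) j b = 0) ∧
      (asTrunc R k).hochschildTwo ((asTruncMk R k).app (asMul R)) b = g := by
  obtain ⟨f, rfl⟩ := asTruncMk_surjective g
  rw [← OperadStructure.Hom.map_hochschildThree, map_eq_zero_iff _ (asTruncMk_injective hk)] at hg
  obtain ⟨b, hbu, hb⟩ := exists_normalized_hochschildTwo_eq hg
  refine ⟨(asTruncMk R k).app b, fun j => ?_, ?_⟩
  · rw [← OperadStructure.Hom.map_plugUnit, hbu j, map_zero]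
  · rw [← OperadStructure.Hom.map_hochschildTwo, hb]

variable {w : WVCollection R (AsTruncModule R k)}

theorem asTrunc_exists_isAssocUnital_lift (hk : 1 ≤ k) (hk4 : k ≠ 4)
    (hw : (asTrunc R k).IsTwoCocycle w) :
    ∃ m, ((asTrunc R k).squareZero hw).IsAssocUnital ((asTruncMk R k).app (asUnit R), 0)
      ((asTruncMk R k).app (asMul R), m) := by
  rcases hk4.lt_or_gt with h | h
  · exact asTrunc_isAssocUnital.exists_lift_of_isTruncated hw
      (asTrunc_eq_zero_of_plugUnit_eq_zero hk) (by omega) (asTrunc_isTruncated hk)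
  · exact asTrunc_isAssocUnital.exists_lift_of_exact hw (asTrunc_eq_zero_of_plugUnit_eq_zero hk)
      fun _ => asTrunc_exists_normalized_hochschildTwo_eq h

theorem asTrunc_mem_B2Star (hk : 1 ≤ k) (hk4 : k ≠ 4) (hw : (asTrunc R k).IsTwoCocycle w) :
    w ∈ (asTrunc R k).B2Star := by
  obtain ⟨m, H⟩ := asTrunc_exists_isAssocUnital_lift hk hk4 hw
  have hkill {n : ℕ} (x) (hx : x ∈ (asOperad R).truncIdeal (asUnit R) k n) :
      H.fromAs.app x = 0 := by
    refine H.fromAs.map_eq_zero_of_mem_truncIdeal hk ?_ hx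
    rw [H.fromAs_asUnit]
    exact (asTrunc_isTruncated hk).squareZero hw 0
  refine OperadStructure.mem_B2Star_of_hom_section hw (H.fromAs.quotientLift _ hkill) fun x => ?_
  obtain ⟨x, rfl⟩ := asTruncMk_surjective x
  refine OperadStructure.Hom.ext_as (φ := H.fromAs.trans (OperadStructure.squareZeroFst hw))
    (ψ := asTruncMk R k) ?_ ?_ x
  · exact congrArg Prod.fst H.fromAs_asUnit
  · exact congrArg Prod.fst H.fromAs_asMul

end AsTrunc

/-! ## Deformations over the dual numbers -/

section DualNumbers

variable (R : Type u) [CommRing R] {N : Type v} [AddCommGroup N] [Module R N]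

/-- The element `x + y ε` of `N[ε] = R[ε] ⊗ N`. -/
noncomputable def dualPair (x y : N) : DualNumber R ⊗[R] N :=
  1 ⊗ₜ[R] x + DualNumber.eps ⊗ₜ[R] y

theorem dualPair_zero_right (x : N) : dualPair R x 0 = 1 ⊗ₜ[R] x := by
  rw [dualPair, TensorProduct.tmul_zero, add_zero]

theorem dualPair_eq_add_eps_smul (x y : N) :
    dualPair R x y = 1 ⊗ₜ[R] x + (DualNumber.eps : DualNumber R) • (1 ⊗ₜ[R] y) := by
  rw [dualPair, TensorProduct.smul_tmul', smul_eq_mul, mul_one]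

theorem dualPair_add (x x' y y' : N) :
    dualPair R (x + x') (y + y') = dualPair R x y + dualPair R x' y' := by
  simp only [dualPair, TensorProduct.tmul_add]
  abel

theorem eps_smul_dualPair (x y : N) :
    (DualNumber.eps : DualNumber R) • dualPair R x y = dualPair R 0 x := by
  simp only [dualPair, smul_add, TensorProduct.smul_tmul', smul_eq_mul, mul_one,
    DualNumber.eps_mul_eps, TensorProduct.zero_tmul, TensorProduct.tmul_zero, add_comm]

variable (N) in
/-- The coefficient of `ε` of an element of `N[ε]`. -/
noncomputable def epsCoeff : DualNumber R ⊗[R] N →ₗ[R] N :=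
  (TensorProduct.lid R N).toLinearMap ∘ₗ (TrivSqZeroExt.sndHom R R).rTensor N

theorem epsCoeff_dualPair (x y : N) : epsCoeff R N (dualPair R x y) = y := by
  simp [epsCoeff, dualPair]

variable {R}

/-- The endomorphism `x ↦ x + d(x) ε` of `N[ε]`. -/
noncomputable def epsShift (d : N →ₗ[R] N) :
    (DualNumber R ⊗[R] N) →ₗ[DualNumber R] (DualNumber R ⊗[R] N) :=
  LinearMap.id + (DualNumber.eps : DualNumber R) • d.baseChange (DualNumber R)

theorem epsShift_one_tmul (d : N →ₗ[R] N) (x : N) :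
    epsShift d (1 ⊗ₜ[R] x) = dualPair R x (d x) := by
  rw [dualPair_eq_add_eps_smul]
  simp [epsShift]

theorem epsShift_dualPair (d : N →ₗ[R] N) (x y : N) :
    epsShift d (dualPair R x y) = dualPair R x (y + d x) := by
  rw [dualPair_eq_add_eps_smul, map_add, map_smul, epsShift_one_tmul, epsShift_one_tmul,
    eps_smul_dualPair, ← dualPair_add, add_zero, add_comm]

theorem epsShift_comp_epsShift_eq_id {d d' : N →ₗ[R] N} (h : d' + d = 0) :
    epsShift d ∘ₗ epsShift d' = LinearMap.id := by
  ext x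
  have hx : d' x + d x = 0 := LinearMap.congr_fun h x
  simp [epsShift_one_tmul, epsShift_dualPair, hx, dualPair_zero_right]

/-- The automorphism `x ↦ x + d(x) ε` of `N[ε]`, with inverse `x ↦ x - d(x) ε`. -/
noncomputable def epsAut (d : N →ₗ[R] N) :
    (DualNumber R ⊗[R] N) ≃ₗ[DualNumber R] (DualNumber R ⊗[R] N) :=
  LinearEquiv.ofLinearMap (epsShift d) (epsShift (-d))
    (epsShift_comp_epsShift_eq_id (neg_add_cancel d))
    (epsShift_comp_epsShift_eq_id (add_neg_cancel d))

theorem epsAut_dualPair (d : N →ₗ[R] N) (x y : N) :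
    epsAut d (dualPair R x y) = dualPair R x (y + d x) :=
  epsShift_dualPair d x y

theorem epsAut_symm_dualPair (d : N →ₗ[R] N) (x y : N) :
    (epsAut d).symm (dualPair R x y) = dualPair R x (y - d x) :=
  (epsShift_dualPair (-d) x y).trans (by rw [LinearMap.neg_apply, sub_eq_add_neg])

end DualNumbers

/-- Transport of an operad structure along linear equivalences. -/
def OperadStructure.transport {S : Type u} [CommRing S] {N : ℕ → Type v} {N' : ℕ → Type v₁}
    [∀ n, AddCommGroup (N n)] [∀ n, Module S (N n)] [∀ n, AddCommGroup (N' n)]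
    [∀ n, Module S (N' n)] (Q : OperadStructure S N) (Φ : ∀ n, N n ≃ₗ[S] N' n) :
    OperadStructure S N' where
  one := Φ 1 Q.one
  act {n} σ := (Φ n).toLinearMap ∘ₗ Q.act σ ∘ₗ (Φ n).symm.toLinearMap
  comp {m n k} h i := ((Q.comp h i).compl₁₂ (Φ m).symm.toLinearMap (Φ n).symm.toLinearMap).compr₂
    (Φ k).toLinearMap
  act_one x := by simp [Q.act_one]
  act_mul σ τ x := by simp [Q.act_mul]
  comp_one h i x := by simp [Q.comp_one]
  one_comp h x := by simp [Q.one_comp]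
  comp_assoc hp hr hq hr' i j a ha x y z := by
    simp [Q.comp_assoc hp hr hq hr' i j a ha]
  comp_comm hp hr hq hr' i k hik a ha b hb x y z := by
    simp [Q.comp_comm hp hr hq hr' i k hik a ha b hb]
  comp_act_right h i x y σ := by simp [Q.comp_act_right]
  comp_act_left h i x y φ := by simp [Q.comp_act_left]

namespace InfinitesimalDeformation

variable {R : Type u} [CommRing R] {M : ℕ → Type v} [∀ n, AddCommGroup (M n)]
  [∀ n, Module R (M n)] {O : OperadStructure R M} (D : InfinitesimalDeformation O)

theorem one_eq_dualPair : D.toOperad.one = dualPair R O.one 0 :=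
  D.one_eq.trans (dualPair_zero_right R _).symm

theorem comp_dualPair {m n k : ℕ} (h : m + n = k + 1) (i : Fin m) (x x' : M m) (y y' : M n) :
    D.toOperad.comp h i (dualPair R x x') (dualPair R y y') =
      dualPair R (O.comp h i x y)
        (D.collection.wp h i x y + (O.comp h i x' y + O.comp h i x y')) := by
  have hcomp (a : M m) (b : M n) : D.toOperad.comp h i (1 ⊗ₜ[R] a) (1 ⊗ₜ[R] b) =
      dualPair R (O.comp h i a b) (D.collection.wp h i a b) := D.comp_eq h i a b
  simp only [dualPair_eq_add_eps_smul R x, dualPair_eq_add_eps_smul R y, map_add, map_smul,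
    LinearMap.add_apply, LinearMap.smul_apply, hcomp, eps_smul_dualPair, ← dualPair_add, add_zero]
  abel_nf

theorem act_dualPair {n : ℕ} (σ : Equiv.Perm (Fin n)) (x x' : M n) :
    D.toOperad.act σ (dualPair R x x') =
      dualPair R (O.act σ x) (D.collection.vs σ x + O.act σ x') := by
  have hact (a : M n) : D.toOperad.act σ (1 ⊗ₜ[R] a) =
      dualPair R (O.act σ a) (D.collection.vs σ a) := D.act_eq σ a
  rw [dualPair_eq_add_eps_smul, map_add, map_smul, hact, hact, eps_smul_dualPair, ← dualPair_add,
    add_zero]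

theorem isTwoCocycle : O.IsTwoCocycle D.collection where
  assoc hp hr hq hr' i j a ha x y z := by
    simpa only [comp_dualPair, epsCoeff_dualPair, map_zero, LinearMap.zero_apply, zero_add,
      add_zero] using congrArg (epsCoeff R _) (D.toOperad.comp_assoc hp hr hq hr' i j a ha
        (dualPair R x 0) (dualPair R y 0) (dualPair R z 0))
  comm hp hr hq hr' i k hik a ha b hb x y z := by
    simpa only [comp_dualPair, epsCoeff_dualPair, map_zero, LinearMap.zero_apply, zero_add,
      add_zero] using congrArg (epsCoeff R _) (D.toOperad.comp_comm hp hr hq hr' i k hik a ha b hb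
        (dualPair R x 0) (dualPair R y 0) (dualPair R z 0))
  act_right h i x y σ := by
    simpa only [comp_dualPair, act_dualPair, epsCoeff_dualPair, map_zero, LinearMap.zero_apply,
      zero_add, add_zero, add_comm] using congrArg (epsCoeff R _)
        (D.toOperad.comp_act_right h i (dualPair R x 0) (dualPair R y 0) σ)
  act_left h i x y φ := by
    simpa only [comp_dualPair, act_dualPair, epsCoeff_dualPair, map_zero, LinearMap.zero_apply,
      zero_add, add_zero, add_comm] using congrArg (epsCoeff R _)
        (D.toOperad.comp_act_left h i (dualPair R x 0) (dualPair R y 0) φ)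
  act_mul x σ τ := by
    simpa only [act_dualPair, epsCoeff_dualPair, map_zero, add_zero] using
      congrArg (epsCoeff R _) (D.toOperad.act_mul σ τ (dualPair R x 0))

theorem map_one_eq_zero_of_collection_eq_coboundary {d : ∀ n, M n →ₗ[R] M n}
    (hd : D.collection = O.coboundary d) : d 1 O.one = 0 := by
  have e := congrArg (epsCoeff R _) (D.toOperad.comp_one rfl 0 D.toOperad.one)
  simpa only [one_eq_dualPair, comp_dualPair, epsCoeff_dualPair, hd, O.coboundary_wp, O.comp_one,
    O.one_comp, map_zero, LinearMap.zero_apply, add_zero, sub_add_cancel_left, neg_eq_zero] using e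

/-- The deformation with zero `℘ς`-collection to which `x ↦ x - d(x) ε` transports a deformation
whose `℘ς`-collection is the coboundary of `d`. -/
noncomputable def trivialization {d : ∀ n, M n →ₗ[R] M n} (hd : D.collection = O.coboundary d) :
    InfinitesimalDeformation O where
  toOperad := D.toOperad.transport fun n => epsAut (-d n)
  collection := 0
  one_eq := by
    change epsAut (-d 1) D.toOperad.one = _
    rw [one_eq_dualPair, epsAut_dualPair, LinearMap.neg_apply,
      D.map_one_eq_zero_of_collection_eq_coboundary hd, neg_zero, add_zero, dualPair_zero_right]
  comp_eq {m n k} h i x y := by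
    change epsAut (-d k) (D.toOperad.comp h i ((epsAut (-d m)).symm _)
      ((epsAut (-d n)).symm _)) = dualPair R _ 0
    rw [← dualPair_zero_right, ← dualPair_zero_right, epsAut_symm_dualPair, epsAut_symm_dualPair,
      comp_dualPair, epsAut_dualPair, hd, O.coboundary_wp]
    simp
  act_eq {m} σ x := by
    change epsAut (-d m) (D.toOperad.act σ ((epsAut (-d m)).symm _)) = dualPair R _ 0
    rw [← dualPair_zero_right, epsAut_symm_dualPair, act_dualPair, epsAut_dualPair, hd,
      O.coboundary_vs]
    simp

theorem isTrivial_of_mem_B2Star (hD : D.collection ∈ O.B2Star) : D.IsTrivial := by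
  obtain ⟨d, hd⟩ := hD
  refine ⟨D.trivialization hd, rfl, fun n => epsAut (-d n), rfl, fun σ x => ?_,
    fun h i x y => ?_, fun n => -d n, fun n x => ?_⟩
  · simp [trivialization, OperadStructure.transport]
  · simp [trivialization, OperadStructure.transport]
  · exact epsShift_one_tmul (-d n) x

end InfinitesimalDeformation

section Cohomology

variable {R : Type u} [CommRing R] {M : ℕ → Type v} [∀ n, AddCommGroup (M n)]
  [∀ n, Module R (M n)] {O : OperadStructure R M}

theorem OperadStructure.subsingleton_H2Star (h : O.Z2Star ≤ O.B2Star) :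
    Subsingleton O.H2Star := by
  rwa [Submodule.Quotient.subsingleton_iff, Submodule.submoduleOf_eq_top]

theorem OperadStructure.subsingleton_H2 (h : O.Z2Star ≤ O.B2Star) : Subsingleton O.H2 := by
  rw [Submodule.Quotient.subsingleton_iff, Submodule.submoduleOf_eq_top]
  exact inf_le_inf_right _ h

end Cohomology

theorem theorem6p8_general (R : Type u) [CommRing R] (k : ℕ) (hk : 1 ≤ k) (hk4 : k ≠ 4) :
    Subsingleton (asTrunc R k).H2 ∧
    Subsingleton (asTrunc R k).H2Star ∧
    ∀ D : InfinitesimalDeformation (asTrunc R k), D.IsTrivial := by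
  have key : (asTrunc R k).Z2Star ≤ (asTrunc R k).B2Star :=
    fun _ hw => asTrunc_mem_B2Star hk hk4 hw
  exact ⟨OperadStructure.subsingleton_H2 key, OperadStructure.subsingleton_H2Star key,
    fun D => D.isTrivial_of_mem_B2Star (key D.isTwoCocycle)⟩

theorem theorem6p8 (𝕜 : Type u) [Field 𝕜] (k : ℕ) (hk : 1 ≤ k) (hk4 : k ≠ 4) :
    Subsingleton (asTrunc 𝕜 k).H2 ∧
    Subsingleton (asTrunc 𝕜 k).H2Star ∧
    ∀ D : InfinitesimalDeformation (asTrunc 𝕜 k), D.IsTrivial :=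
  theorem6p8_general 𝕜 k hk hk4
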